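/- Let $n\ge 3$ and $k\ge 1$ be integers and let $T$ be a real number with $$\frac{2\pi (k-1)}{\sqrt{n-2}} < T \le \frac{2\pi k}{\sqrt{n-2}} .$$ Let $g_0 = dt^2+d\xi^2$ be the product metric on $S^1(T)\times S^{n-1}$, where $S^1(T)$ is the circle of length $T$ and $(S^{n-1},d\xi^2)$ is the unit sphere of $\mathbb{R}^n$, and let $[g_0]=\{f g_0 : f \text{ smooth and positive}\}$ be its conformal class. Call a metric $g\in[g_0]$ pseudo-cylindric if it is rotationally invariant (invariant under the action of $O(n)$ on the factor $S^{n-1}$) and has constant positive scalar curvature. Call two metrics $g,h$ equivalent if $h = c\,\rho^* g$ for a constant $c>0$ and a rotation $\rho$ of the factor $S^1(T)$. Then $[g_0]$ contains exactly $k$ pseudo-cylindric metrics up to equivalence: there are pseudo-cylindric metrics $g^0=g_0,\ g^1,\dots,g^{k-1}$ in $[g_0]$ that are pairwise inequivalent, and every pseudo-cylindric metric in $[g_0]$ is equivalent to one of them. In particular, if $k=1$, then every pseudo-cylindric metric in $[g_0]$ is a constant multiple $c\,g_0$, $c>0$, of the product metric. -/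

import Mathlib

open scoped Manifold ContDiff

noncomputable section

namespace PseudoCyl

/-! ### Fields of bilinear forms on a manifold -/

section General

variable {E : Type*} [NormedAddCommGroup E] [NormedSpace ℝ E]
  {H : Type*} [TopologicalSpace H]
  {M : Type*} [TopologicalSpace M] [ChartedSpace H M]
  {E' : Type*} [NormedAddCommGroup E'] [NormedSpace ℝ E']
  {H' : Type*} [TopologicalSpace H']
  {N : Type*} [TopologicalSpace N] [ChartedSpace H' N]

/-- A covariant 2-tensor field on `M`: a bilinear form on each tangent space.
Riemannian metrics are particular such fields. -/
abbrev TwoTensor (I : ModelWithCorners ℝ E H) (M : Type*) [TopologicalSpace M]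
    [ChartedSpace H M] : Type _ :=
  ∀ p : M, LinearMap.BilinForm ℝ (TangentSpace I p)

/-- The pullback `φ^* g`, that is `(φ^* g)_p (v, w) = g_{φ p} (dφ_p v, dφ_p w)`. -/
def pullback (I : ModelWithCorners ℝ E H) (J : ModelWithCorners ℝ E' H')
    (φ : M → N) (g : TwoTensor J N) : TwoTensor I M :=
  fun p => LinearMap.BilinForm.comp (g (φ p))
    (mfderiv I J φ p).toLinearMap (mfderiv I J φ p).toLinearMap

/-- The conformal class `[g]`: all `f g` with `f` a smooth positive function. -/
def conformalClass (I : ModelWithCorners ℝ E H) (g : TwoTensor I M) : Set (TwoTensor I M) :=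
  {h | ∃ f : M → ℝ, ContMDiff I 𝓘(ℝ, ℝ) ∞ f ∧ (∀ p, 0 < f p) ∧ ∀ p, h p = f p • g p}

/-! ### Scalar curvature in coordinates -/

variable {ι : Type*} [Fintype ι] [DecidableEq ι]

/-- Partial derivative in the direction of the `i`-th basis vector. -/
def partialDeriv (b : Module.Basis ι ℝ E) (i : ι) (f : E → ℝ) (x : E) : ℝ :=
  fderiv ℝ f x (b i)

/-- Christoffel symbols of a matrix-valued function `G = (g_ij)`:
`Γ^k_ij = (1/2) ∑_l g^{kl} (∂_i g_jl + ∂_j g_il - ∂_l g_ij)`. -/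
def christoffel (b : Module.Basis ι ℝ E) (G : E → Matrix ι ι ℝ) (k i j : ι) (x : E) : ℝ :=
  (1 / 2 : ℝ) * ∑ l, (G x)⁻¹ k l *
    (partialDeriv b i (fun y => G y j l) x + partialDeriv b j (fun y => G y i l) x
      - partialDeriv b l (fun y => G y i j) x)

/-- Ricci curvature in coordinates:
`R_ij = ∑_k (∂_k Γ^k_ij - ∂_j Γ^k_ik) + ∑_{k,l} (Γ^k_kl Γ^l_ij - Γ^k_jl Γ^l_ik)`. -/
def ricci (b : Module.Basis ι ℝ E) (G : E → Matrix ι ι ℝ) (i j : ι) (x : E) : ℝ :=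
  ∑ k, (partialDeriv b k (christoffel b G k i j) x - partialDeriv b j (christoffel b G k i k) x)
    + ∑ k, ∑ l, (christoffel b G k k l x * christoffel b G l i j x
      - christoffel b G k j l x * christoffel b G l i k x)

/-- Scalar curvature in coordinates: `∑_{i,j} g^{ij} R_ij`. -/
def coordScalar (b : Module.Basis ι ℝ E) (G : E → Matrix ι ι ℝ) (x : E) : ℝ :=
  ∑ i, ∑ j, (G x)⁻¹ i j * ricci b G i j x

/-- The components `g_ij` of `g` in the preferred chart `φ` of `M` around `p`, with respect to
the basis `b` of the model vector space: the Gram matrix of `(φ⁻¹)^* g`. -/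
def metricCoeff (I : ModelWithCorners ℝ E H) (b : Module.Basis ι ℝ E) (g : TwoTensor I M) (p : M)
    (x : E) : Matrix ι ι ℝ :=
  Matrix.of fun i j => pullback 𝓘(ℝ, E) I (extChartAt I p).symm g x (b i) (b j)

/-- The scalar curvature of the metric `g` at `p`, computed in the preferred chart around `p`
with respect to the linear coordinates given by `b` (its value depends on neither choice). -/
def scalarCurvature (I : ModelWithCorners ℝ E H) (b : Module.Basis ι ℝ E) (g : TwoTensor I M)
    (p : M) : ℝ :=
  coordScalar b (metricCoeff I b g p) (extChartAt I p p)

end General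

/-! ### The Riemannian product of a circle of length `T` and a unit sphere -/

/-- The unit sphere `S^m` in `ℝ^{m+1}`. -/
abbrev Sph (m : ℕ) : Type := Metric.sphere (0 : EuclideanSpace ℝ (Fin (m + 1))) 1

/-- The product manifold `S^1 × S^m`. -/
abbrev Cyl (m : ℕ) : Type := Circle × Sph m

/-- The model with corners of `S^1 × S^m`. -/
abbrev cylModel (m : ℕ) := (𝓡 1).prod (𝓡 m)

/-- The standard basis of the model vector space `ℝ^1 × ℝ^m`. -/
def cylBasis (m : ℕ) :
    Module.Basis (Fin 1 ⊕ Fin m) ℝ (EuclideanSpace ℝ (Fin 1) × EuclideanSpace ℝ (Fin m)) :=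
  (EuclideanSpace.basisFun (Fin 1) ℝ).toBasis.prod (EuclideanSpace.basisFun (Fin m) ℝ).toBasis

/-- The flat metric of a Euclidean vector space. -/
def flatMetric (V : Type*) [NormedAddCommGroup V] [InnerProductSpace ℝ V] :
    TwoTensor 𝓘(ℝ, V) V :=
  fun _ => innerₗ V

/-- The metric of the circle of length `T`: the unit circle, of length `2π`, with its induced
metric multiplied by `(T / 2π)²`. -/
def circleMetric (T : ℝ) : TwoTensor (𝓡 1) Circle :=
  fun p => (T / (2 * Real.pi)) ^ 2 •
    pullback (𝓡 1) 𝓘(ℝ, ℂ) (fun z : Circle => (z : ℂ)) (flatMetric ℂ) p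

/-- The standard metric `dξ²` of the unit sphere, induced by the ambient Euclidean space. -/
def sphereMetric (m : ℕ) : TwoTensor (𝓡 m) (Sph m) :=
  pullback (𝓡 m) 𝓘(ℝ, EuclideanSpace ℝ (Fin (m + 1))) (fun ξ : Sph m => ξ.1) (flatMetric _)

/-- The product metric `dt² + dξ²` on `S^1(T) × S^m`. -/
def productMetric (T : ℝ) (m : ℕ) : TwoTensor (cylModel m) (Cyl m) :=
  fun p => pullback (cylModel m) (𝓡 1) Prod.fst (circleMetric T) p
    + pullback (cylModel m) (𝓡 m) Prod.snd (sphereMetric m) p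

/-- The map `(z, ξ) ↦ (z, A ξ)` of `S^1 × S^m` given by an orthogonal transformation `A`. -/
def rotateSphere (m : ℕ)
    (A : EuclideanSpace ℝ (Fin (m + 1)) ≃ₗᵢ[ℝ] EuclideanSpace ℝ (Fin (m + 1))) :
    Cyl m → Cyl m :=
  fun p => (p.1, ⟨A p.2.1, by simp⟩)

/-- The map `(z, ξ) ↦ (a z, ξ)` of `S^1 × S^m` given by a rotation `a` of the circle. -/
def rotateCircle (m : ℕ) (a : Circle) : Cyl m → Cyl m :=
  fun p => (a * p.1, p.2)

/-- `g` is invariant under all rotations and reflections of the sphere factor. -/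
def RotationallyInvariant (m : ℕ) (g : TwoTensor (cylModel m) (Cyl m)) : Prop :=
  ∀ A, pullback (cylModel m) (cylModel m) (rotateSphere m A) g = g

/-- `g` has constant positive scalar curvature. -/
def ConstPosScalar (m : ℕ) (g : TwoTensor (cylModel m) (Cyl m)) : Prop :=
  ∃ R : ℝ, 0 < R ∧ ∀ p, scalarCurvature (cylModel m) (cylBasis m) g p = R

/-- The pseudo-cylindric metrics on `S^1(T) × S^m`: rotationally invariant metrics of constant
positive scalar curvature in the conformal class of the product metric. -/
def IsPseudoCylindric (T : ℝ) (m : ℕ) (g : TwoTensor (cylModel m) (Cyl m)) : Prop :=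
  g ∈ conformalClass (cylModel m) (productMetric T m) ∧
    RotationallyInvariant m g ∧ ConstPosScalar m g

/-- `h` and `g` agree up to a constant factor and a rotation of the circle factor. -/
def Equivalent (m : ℕ) (h g : TwoTensor (cylModel m) (Cyl m)) : Prop :=
  ∃ c : ℝ, 0 < c ∧ ∃ a : Circle,
    ∀ p, h p = c • pullback (cylModel m) (cylModel m) (rotateCircle m a) g p

end PseudoCyl

end

noncomputable section

namespace PseudoCyl

/-! ### Scalar curvature of a warped diagonal metric in stereographic coordinates -/

/-! Put `n = N + 2`, `m = N + 1`. Rotations act by isometries of the product metric, so a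
rotationally invariant conformal factor depends only on arc length `t` on the circle. Write it as
`X⁻²`. The scalar curvature is then `m((m-1)X² + 2XX'' - (m+1)X'²)` (`scalarCurvature_conformal`).
If it is constant, the equation has a first integral and becomes `X'' = X - κX^(N+1)`; periodicity
forces `κ > 0`, and scaling gives `κ = 1` (`exists_isSol_of_scalar_const`). Conversely, conservation
of energy makes the scalar curvature of a solution constant (`IsSol.isPseudoCylindric`). Equivalence
of metrics becomes scaling and translation of `X` (`equivalent_iff`). It remains to count the
positive `T`-periodic solutions of `x'' = x - x^(N+1)` up to translation
(`exists_periodic_solutions`).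

On `x > 0` this is motion in a single potential well with bottom at `x = 1`. The linearized period
at the bottom is `2π/√N`, the period grows strictly with the amplitude, and it is unbounded as the
energy approaches that of the rest point `0`. So each `P > 2π/√N` is the least period of exactly one
orbit. A nonconstant `T`-periodic solution has least period `T/j`, and `T/j > 2π/√N` holds exactly
for `1 ≤ j ≤ k - 1`. Together with `x = 1` this makes `k` solutions.

Monotonicity of the period (`strictMonoOn_period`) is Chicone's criterion: with potential `V` and `F
= V'`, convexity of `W = V/F²` suffices. In the coordinate `s = ±√V` an orbit is `s = ρ cos θ`, its
period is `∫ √2 √W dθ`, and `√W` as a function of `s` has derivative `W'`. It is therefore convex,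
and averaging over `±s` shows that the integral increases with `ρ`. -/

theorem partialDeriv_inl {m : ℕ} {α α' : ℝ → ℝ} {β : EuclideanSpace ℝ (Fin m) → ℝ}
    {β' : EuclideanSpace ℝ (Fin m) →L[ℝ] ℝ}
    {x : EuclideanSpace ℝ (Fin 1) × EuclideanSpace ℝ (Fin m)}
    (hα : HasDerivAt α (α' (x.1 0)) (x.1 0)) (hβ : HasFDerivAt β β' x.2) (i : Fin 1) :
    partialDeriv (cylBasis m) (Sum.inl i) (fun x => α (x.1 0) * β x.2) x
      = α' (x.1 0) * β x.2 := by
  have h1 : HasFDerivAt (fun x : EuclideanSpace ℝ (Fin 1) × EuclideanSpace ℝ (Fin m) => x.1 0)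
      ((EuclideanSpace.proj (𝕜 := ℝ) (0 : Fin 1)).comp (ContinuousLinearMap.fst ℝ _ _)) x :=
    ((EuclideanSpace.proj (𝕜 := ℝ) (0 : Fin 1)).comp
      (ContinuousLinearMap.fst ℝ _ (EuclideanSpace ℝ (Fin m)))).hasFDerivAt
  have h2 := (hα.comp_hasFDerivAt x h1).mul (hβ.comp x hasFDerivAt_snd)
  have h3 : (fun x : EuclideanSpace ℝ (Fin 1) × EuclideanSpace ℝ (Fin m) => α (x.1 0) * β x.2)
    = ((α ∘ fun x => x.1 0) * (β ∘ Prod.snd)) := rfl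
  rw [partialDeriv, h3, h2.fderiv]
  fin_cases i
  simp [cylBasis, mul_comm]

theorem partialDeriv_inr {m : ℕ} {α α' : ℝ → ℝ} {β : EuclideanSpace ℝ (Fin m) → ℝ}
    {β' : EuclideanSpace ℝ (Fin m) →L[ℝ] ℝ}
    {x : EuclideanSpace ℝ (Fin 1) × EuclideanSpace ℝ (Fin m)}
    (hα : HasDerivAt α (α' (x.1 0)) (x.1 0)) (hβ : HasFDerivAt β β' x.2) (j : Fin m) :
    partialDeriv (cylBasis m) (Sum.inr j) (fun x => α (x.1 0) * β x.2) x
      = α (x.1 0) * β' (EuclideanSpace.single j 1) := by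
  have h1 : HasFDerivAt (fun x : EuclideanSpace ℝ (Fin 1) × EuclideanSpace ℝ (Fin m) => x.1 0)
      ((EuclideanSpace.proj (𝕜 := ℝ) (0 : Fin 1)).comp (ContinuousLinearMap.fst ℝ _ _)) x :=
    ((EuclideanSpace.proj (𝕜 := ℝ) (0 : Fin 1)).comp
      (ContinuousLinearMap.fst ℝ _ (EuclideanSpace ℝ (Fin m)))).hasFDerivAt
  have h2 := (hα.comp_hasFDerivAt x h1).mul (hβ.comp x hasFDerivAt_snd)
  have h3 : (fun x : EuclideanSpace ℝ (Fin 1) × EuclideanSpace ℝ (Fin m) => α (x.1 0) * β x.2)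
    = ((α ∘ fun x => x.1 0) * (β ∘ Prod.snd)) := rfl
  rw [partialDeriv, h3, h2.fderiv]
  simp [cylBasis]

theorem partialDeriv_zero {m : ℕ} (i : Fin 1 ⊕ Fin m)
    (x : EuclideanSpace ℝ (Fin 1) × EuclideanSpace ℝ (Fin m)) :
    partialDeriv (cylBasis m) i (fun _ => 0) x = 0 := by
  simp [partialDeriv]

/-- The conformal factor `16 / (|y|² + 4)²` of the round metric in stereographic coordinates. -/
def stereoFactor {V : Type*} [NormedAddCommGroup V] (y : V) : ℝ := 16 / (‖y‖ ^ 2 + 4) ^ 2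

theorem stereoFactor_pos {V : Type*} [NormedAddCommGroup V] (y : V) : 0 < stereoFactor y := by
  unfold stereoFactor; positivity

theorem hasFDerivAt_stereoFactor {V : Type*} [NormedAddCommGroup V] [InnerProductSpace ℝ V]
    (y : V) : HasFDerivAt (stereoFactor (V := V))
      ((-64 / (‖y‖ ^ 2 + 4) ^ 3) • innerSL ℝ y) y := by
  have h0 : ‖y‖ ^ 2 + 4 ≠ 0 := by positivity
  have h1 : HasFDerivAt (fun z : V => ‖z‖ ^ 2) (2 • innerSL ℝ y) y :=
    (hasStrictFDerivAt_norm_sq y).hasFDerivAt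
  have h2 : HasDerivAt (fun r : ℝ => 16 / (r + 4) ^ 2) (-32 / (‖y‖ ^ 2 + 4) ^ 3) (‖y‖ ^ 2) := by
    have := (((hasDerivAt_id (‖y‖ ^ 2)).add_const 4).pow 2).fun_inv (by simpa using h0)
    have := this.const_mul 16
    refine (this.congr_deriv ?_).congr_of_eventuallyEq ?_
    · simp; field_simp; norm_num
    · exact Filter.Eventually.of_forall fun r => by simp [div_eq_mul_inv]
  refine (h2.comp_hasFDerivAt y h1).congr_fderiv ?_
  ext v
  simp
  ring

/-- The diagonal metric `A(s) ds² + B(s) 16 |dy|² / (|y|² + 4)²`. -/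
def warpedCoeff (m : ℕ) (A B : ℝ → ℝ)
    (x : EuclideanSpace ℝ (Fin 1) × EuclideanSpace ℝ (Fin m)) :
    Matrix (Fin 1 ⊕ Fin m) (Fin 1 ⊕ Fin m) ℝ :=
  Matrix.diagonal (Sum.elim (fun _ => A (x.1 0)) (fun _ => B (x.1 0) * stereoFactor x.2))

theorem warpedCoeff_inv {m : ℕ} {A B : ℝ → ℝ} (hA : ∀ s, 0 < A s) (hB : ∀ s, 0 < B s)
    (x : EuclideanSpace ℝ (Fin 1) × EuclideanSpace ℝ (Fin m)) :
    (warpedCoeff m A B x)⁻¹ = Matrix.diagonal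
      (Sum.elim (fun _ => (A (x.1 0))⁻¹) (fun _ => (B (x.1 0) * stereoFactor x.2)⁻¹)) := by
  apply Matrix.inv_eq_left_inv
  have h1 := (hA (x.1 0)).ne'
  have h2 := (mul_pos (hB (x.1 0)) (stereoFactor_pos x.2)).ne'
  rw [warpedCoeff, Matrix.diagonal_mul_diagonal, ← Matrix.diagonal_one]
  congr 1
  funext i
  rcases i with i | i
  · simp [h1]
  · simp only [Sum.elim_inr]
    exact inv_mul_cancel₀ h2

section Warped

variable {m : ℕ} {A A' B B' : ℝ → ℝ}

theorem warped_pd_inl (hA : ∀ s, HasDerivAt A (A' s) s) (hB : ∀ s, HasDerivAt B (B' s) s)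
    (p q : Fin 1 ⊕ Fin m) (i : Fin 1) (x : EuclideanSpace ℝ (Fin 1) × EuclideanSpace ℝ (Fin m)) :
    partialDeriv (cylBasis m) (Sum.inl i) (fun y => warpedCoeff m A B y p q) x =
      Matrix.diagonal (Sum.elim (fun _ => A' (x.1 0)) (fun _ => B' (x.1 0) * stereoFactor x.2))
        p q := by
  have e1 := partialDeriv_inl (m := m) (x := x) (hA (x.1 0)) (hasFDerivAt_const 1 x.2) i
  have e2 := partialDeriv_inl (m := m) (x := x) (hB (x.1 0)) (hasFDerivAt_stereoFactor x.2) i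
  simp only [mul_one] at e1
  by_cases h : p = q
  · subst h
    rcases p with p | p <;> simp [warpedCoeff, e1, e2]
  · simp [warpedCoeff, Matrix.diagonal_apply_ne _ h, partialDeriv_zero]

theorem warped_pd_inr (hA : ∀ s, HasDerivAt A (A' s) s) (hB : ∀ s, HasDerivAt B (B' s) s)
    (p q : Fin 1 ⊕ Fin m) (j : Fin m) (x : EuclideanSpace ℝ (Fin 1) × EuclideanSpace ℝ (Fin m)) :
    partialDeriv (cylBasis m) (Sum.inr j) (fun y => warpedCoeff m A B y p q) x =
      Matrix.diagonal (Sum.elim (fun _ => 0)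
        (fun _ => B (x.1 0) * (-64 / (‖x.2‖ ^ 2 + 4) ^ 3 * x.2 j))) p q := by
  have e1 := partialDeriv_inr (m := m) (x := x) (hA (x.1 0)) (hasFDerivAt_const 1 x.2) j
  have e2 := partialDeriv_inr (m := m) (x := x) (hB (x.1 0)) (hasFDerivAt_stereoFactor x.2) j
  simp only [mul_one] at e1
  by_cases h : p = q
  · subst h
    rcases p with p | p
    · simp [warpedCoeff, e1]
    · simp only [warpedCoeff, Matrix.diagonal_apply_eq, Sum.elim_inr, e2]
      simp [EuclideanSpace.inner_single_right]
  · simp [warpedCoeff, Matrix.diagonal_apply_ne _ h, partialDeriv_zero]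

variable (hA : ∀ s, HasDerivAt A (A' s) s) (hB : ∀ s, HasDerivAt B (B' s) s)
  (hA0 : ∀ s, 0 < A s) (hB0 : ∀ s, 0 < B s)

include hA hB hA0 hB0

/-- Every symbol is displayed as a product of a function of `s` and a function of `y`, with idle
factors `1`, so that `partialDeriv_inl` and `partialDeriv_inr` apply to it directly. -/
theorem christoffel_warped (k i j : Fin 1 ⊕ Fin m) :
    christoffel (cylBasis m) (warpedCoeff m A B) k i j =
      match k, i, j with
      | .inl _, .inl _, .inl _ => fun x => A' (x.1 0) / (2 * A (x.1 0)) * 1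
      | .inl _, .inl _, .inr _ => fun _ => 0
      | .inl _, .inr _, .inl _ => fun _ => 0
      | .inl _, .inr i, .inr j => fun x =>
          (if i = j then (- (B' (x.1 0) / (2 * A (x.1 0)))) else 0) * stereoFactor x.2
      | .inr _, .inl _, .inl _ => fun _ => 0
      | .inr k, .inl _, .inr j => fun x => (if j = k then B' (x.1 0) / (2 * B (x.1 0)) else 0) * 1
      | .inr k, .inr i, .inl _ => fun x => (if i = k then B' (x.1 0) / (2 * B (x.1 0)) else 0) * 1
      | .inr k, .inr i, .inr j => fun x => 1 * ((-2 / (‖x.2‖ ^ 2 + 4)) *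
          ((if j = k then x.2 i else 0) + (if i = k then x.2 j else 0)
            - (if i = j then x.2 k else 0))) := by
  funext x
  have h1 := (hA0 (x.1 0)).ne'
  have h2 := (hB0 (x.1 0)).ne'
  have h3 : ‖x.2‖ ^ 2 + 4 ≠ 0 := by positivity
  have h4 := (stereoFactor_pos x.2).ne'
  have h5 : -64 / (‖x.2‖ ^ 2 + 4) ^ 3 = stereoFactor x.2 * (-4 / (‖x.2‖ ^ 2 + 4)) := by
    unfold stereoFactor; field_simp; norm_num
  rw [christoffel, warpedCoeff_inv hA0 hB0]
  rw [Finset.sum_eq_single k (fun l _ hl => by rw [Matrix.diagonal_apply_ne' _ hl, zero_mul])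
    (by simp)]
  rw [Matrix.diagonal_apply_eq]
  rcases k with k | k <;> rcases i with i | i <;> rcases j with j | j <;>
    simp only [warped_pd_inl hA hB, warped_pd_inr hA hB, Matrix.diagonal_apply, Sum.elim_inl,
      Sum.elim_inr, Sum.inl.injEq, Sum.inr.injEq, reduceCtorEq, if_false,
      eq_iff_true_of_subsingleton, if_true, h5] <;>
    (try split_ifs) <;> subst_vars <;> (try contradiction) <;> field_simp <;> ring

/-- The preferred charts are centred, so the origin is the only point needed; there the purely
spherical Christoffel symbols vanish. The inverse metric is diagonal, so diagonal Ricci entries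
suffice. -/
theorem ricci_warped_inl {b' : ℝ} (hb : HasDerivAt (fun s => B' s / (2 * B s)) b' 0) (i : Fin 1) :
    ricci (cylBasis m) (warpedCoeff m A B) (Sum.inl i) (Sum.inl i) 0 =
      - m * b' + m * (A' 0 / (2 * A 0)) * (B' 0 / (2 * B 0)) - m * (B' 0 / (2 * B 0)) ^ 2 := by
  obtain rfl : i = default := Subsingleton.elim _ _
  have e0 (k : Fin m) : partialDeriv (cylBasis m) (Sum.inr k)
      (christoffel (cylBasis m) (warpedCoeff m A B) (.inr k) (.inl default) (.inl default)) 0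
      = 0 := by
    rw [christoffel_warped hA hB hA0 hB0]
    exact partialDeriv_zero _ _
  have e1 (k : Fin m) : partialDeriv (cylBasis m) (Sum.inl default)
      (christoffel (cylBasis m) (warpedCoeff m A B) (.inr k) (.inl default) (.inr k)) 0 = b' := by
    rw [christoffel_warped hA hB hA0 hB0]
    simp only [if_true]
    refine (partialDeriv_inl (α := fun s => B' s / (2 * B s)) (α' := fun _ => b')
      (β := fun _ => 1) hb (hasFDerivAt_const 1 _) _).trans (mul_one _)
  simp only [ricci, Fintype.sum_sum_type, Finset.univ_unique, Finset.sum_singleton, sub_self, e0,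
    e1]
  simp [christoffel_warped hA hB hA0 hB0]
  ring

theorem ricci_warped_inr {b' : ℝ} (hb : HasDerivAt (fun s => B' s / (2 * A s)) b' 0) (i : Fin m) :
    ricci (cylBasis m) (warpedCoeff m A B) (Sum.inr i) (Sum.inr i) 0 =
      (m - 1) - b' - (A' 0 / (2 * A 0) + m * (B' 0 / (2 * B 0))) * (B' 0 / (2 * A 0))
       + 2 * (B' 0 / (2 * B 0)) * (B' 0 / (2 * A 0)) := by
  have h0 : stereoFactor (0 : EuclideanSpace ℝ (Fin m)) = 1 := by norm_num [stereoFactor]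
  have e0 : partialDeriv (cylBasis m) (Sum.inr i)
      (christoffel (cylBasis m) (warpedCoeff m A B) (.inl default) (.inr i) (.inl default)) 0
      = 0 := by
    rw [christoffel_warped hA hB hA0 hB0]
    exact partialDeriv_zero _ _
  have e1 : partialDeriv (cylBasis m) (Sum.inl default)
      (christoffel (cylBasis m) (warpedCoeff m A B) (.inl default) (.inr i) (.inr i)) 0
      = -b' := by
    rw [christoffel_warped hA hB hA0 hB0]
    simp only [if_true]
    have := partialDeriv_inl (α := fun s => -(B' s / (2 * A s))) (α' := fun _ => -b')
      (x := 0) hb.neg (hasFDerivAt_stereoFactor (0 : EuclideanSpace ℝ (Fin m))) default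
    rw [this]
    simp [h0]
  have e2 (k i j l : Fin m) : partialDeriv (cylBasis m) (Sum.inr l)
      (christoffel (cylBasis m) (warpedCoeff m A B) (.inr k) (.inr i) (.inr j)) 0 =
      -1 / 2 * ((if j = k then if i = l then 1 else 0 else 0)
        + (if i = k then if j = l then 1 else 0 else 0)
        - (if i = j then if k = l then 1 else 0 else 0)) := by
    rw [christoffel_warped hA hB hA0 hB0]
    -- The bracket is a linear form vanishing at `0`, so the product rule at `0` leaves only `-2/4`
    -- times that form.
    let ℓ : EuclideanSpace ℝ (Fin m) →L[ℝ] ℝ :=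
      (if j = k then EuclideanSpace.proj i else 0) + (if i = k then EuclideanSpace.proj j else 0)
            - (if i = j then EuclideanSpace.proj k else 0)
    have hℓ (y : EuclideanSpace ℝ (Fin m)) : (if j = k then y i else 0) +
        (if i = k then y j else 0) - (if i = j then y k else 0) = ℓ y := by
      simp only [ℓ]; split_ifs <;> simp
    have h1 : DifferentiableAt ℝ (fun y : EuclideanSpace ℝ (Fin m) => -2 / (‖y‖ ^ 2 + 4)) 0 := by
      have h : DifferentiableAt ℝ (fun y : EuclideanSpace ℝ (Fin m) => ‖y‖ ^ 2 + 4) 0 :=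
        ((contDiff_norm_sq ℝ (n := 1)).differentiable one_ne_zero _).add_const _
      simp only [div_eq_mul_inv]
      exact (h.fun_inv (by simp)).const_mul _
    have h2 := h1.hasFDerivAt.mul ℓ.hasFDerivAt
    have := partialDeriv_inr (α := fun _ => 1) (α' := fun _ => 0)
      (x := (0 : EuclideanSpace ℝ (Fin 1) × EuclideanSpace ℝ (Fin m))) (hasDerivAt_const _ _) h2 l
    simp only [hℓ]
    refine Eq.trans this ?_
    have h3 := hℓ (EuclideanSpace.single l 1)
    simp only [PiLp.single_apply] at h3
    rw [h3]
    simp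
    norm_num
  simp only [ricci, Fintype.sum_sum_type, Finset.univ_unique, Finset.sum_singleton, e0, e1, e2]
  simp [christoffel_warped hA hB hA0 hB0, h0, ← ite_and]
  ring_nf
  simp only [Finset.sum_sub_distrib, Finset.sum_ite_eq, Finset.sum_const, Finset.mem_univ, if_true,
    Finset.card_univ, Fintype.card_fin, nsmul_eq_mul]
  ring

theorem coordScalar_warped (hm : 0 < m) {B₂ : ℝ} (hB2 : HasDerivAt B' B₂ 0) :
    coordScalar (cylBasis m) (warpedCoeff m A B) 0 =
      m * (m - 1) / B 0 - m / A 0 * (2 * ((B₂ * B 0 - B' 0 ^ 2) / (2 * B 0 ^ 2))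
        - 2 * (A' 0 / (2 * A 0)) * (B' 0 / (2 * B 0))
        + (m + 1) * (B' 0 / (2 * B 0)) ^ 2) := by
  have ha := (hA0 0).ne'
  have hb := (hB0 0).ne'
  have h1 := hB2.fun_div ((hB 0).const_mul 2) (by simpa using hb)
  have h2 := hB2.fun_div ((hA 0).const_mul 2) (by simpa using ha)
  have h0 : stereoFactor (0 : EuclideanSpace ℝ (Fin m)) = 1 := by norm_num [stereoFactor]
  have key (i : Fin 1 ⊕ Fin m) : ∑ j, (warpedCoeff m A B 0)⁻¹ i j *
      ricci (cylBasis m) (warpedCoeff m A B) i j 0 = (warpedCoeff m A B 0)⁻¹ i i *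
      ricci (cylBasis m) (warpedCoeff m A B) i i 0 := by
    refine Finset.sum_eq_single i (fun j _ hj => ?_) (by simp)
    rw [warpedCoeff_inv hA0 hB0, Matrix.diagonal_apply_ne' _ hj, zero_mul]
  rw [coordScalar, Finset.sum_congr rfl fun i _ => key i, Fintype.sum_sum_type]
  simp only [ricci_warped_inl hA hB hA0 hB0 h1,
    ricci_warped_inr hA hB hA0 hB0 h2, warpedCoeff_inv hA0 hB0]
  simp [h0]
  field_simp
  ring

end Warped

end PseudoCyl

end

noncomputable section

namespace PseudoCyl

/-! ### The product metric -/

theorem contMDiff_coe_circle {n : ℕ∞ω} : ContMDiff (𝓡 1) 𝓘(ℝ, ℂ) n (fun z : Circle => (z : ℂ)) :=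
  haveI := finrank_real_complex_fact'
  contMDiff_coe_sphere (E := ℂ) (n := 1)

theorem contMDiff_coe_sph {n : ℕ∞ω} (m : ℕ) :
    ContMDiff (𝓡 m) 𝓘(ℝ, EuclideanSpace ℝ (Fin (m + 1))) n (fun ξ : Sph m => ξ.1) :=
  have := Fact.mk (@finrank_euclideanSpace_fin ℝ _ (m + 1))
  contMDiff_coe_sphere

section PullbackProduct

variable {E : Type*} [NormedAddCommGroup E] [NormedSpace ℝ E]
  {H : Type*} [TopologicalSpace H] {I : ModelWithCorners ℝ E H}
  {M : Type*} [TopologicalSpace M] [ChartedSpace H M]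

/-- By the chain rule the intrinsic tangent maps merge into derivatives of maps into `ℂ` and
Euclidean space, where ordinary calculus applies. -/
theorem pullback_productMetric_apply (T : ℝ) (m : ℕ) {φ : M → Cyl m} {x : M}
    (hφ : MDifferentiableAt I (cylModel m) φ x) (v w : TangentSpace I x) :
    pullback I (cylModel m) φ (productMetric T m) x v w =
      (T / (2 * Real.pi)) ^ 2 *
        inner ℝ (show ℂ from mfderiv I 𝓘(ℝ, ℂ) (fun y => ((φ y).1 : ℂ)) x v)
          (show ℂ from mfderiv I 𝓘(ℝ, ℂ) (fun y => ((φ y).1 : ℂ)) x w)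
      + inner ℝ
          (show EuclideanSpace ℝ (Fin (m + 1)) from
            mfderiv I 𝓘(ℝ, EuclideanSpace ℝ (Fin (m + 1))) (fun y => (φ y).2.1) x v)
          (show EuclideanSpace ℝ (Fin (m + 1)) from
            mfderiv I 𝓘(ℝ, EuclideanSpace ℝ (Fin (m + 1))) (fun y => (φ y).2.1) x w) := by
  have h1 : MDifferentiableAt (𝓡 1) 𝓘(ℝ, ℂ) (fun z : Circle => (z : ℂ)) (φ x).1 :=
    (contMDiff_coe_circle (n := 1)).mdifferentiable one_ne_zero _
  have h2 : MDifferentiableAt (𝓡 m) 𝓘(ℝ, EuclideanSpace ℝ (Fin (m + 1)))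
      (fun ξ : Sph m => ξ.1) (φ x).2 :=
    (contMDiff_coe_sph m (n := 1)).mdifferentiable one_ne_zero _
  have e1 : mfderiv I 𝓘(ℝ, ℂ) (fun y => ((φ y).1 : ℂ)) x =
      (mfderiv (𝓡 1) 𝓘(ℝ, ℂ) (fun z : Circle => (z : ℂ)) (φ x).1).comp
        ((mfderiv (cylModel m) (𝓡 1) Prod.fst (φ x)).comp (mfderiv I (cylModel m) φ x)) := by
    rw [← mfderiv_comp x mdifferentiableAt_fst hφ]
    exact mfderiv_comp x h1 (mdifferentiableAt_fst.comp x hφ)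
  have e2 : mfderiv I 𝓘(ℝ, EuclideanSpace ℝ (Fin (m + 1))) (fun y => (φ y).2.1) x =
      (mfderiv (𝓡 m) 𝓘(ℝ, EuclideanSpace ℝ (Fin (m + 1))) (fun ξ : Sph m => ξ.1) (φ x).2).comp
        ((mfderiv (cylModel m) (𝓡 m) Prod.snd (φ x)).comp (mfderiv I (cylModel m) φ x)) := by
    rw [← mfderiv_comp x mdifferentiableAt_snd hφ]
    exact mfderiv_comp x h2 (mdifferentiableAt_snd.comp x hφ)
  rw [e1, e2]
  rfl

end PullbackProduct

/-! ### Symmetries of the product metric and their effect on conformal factors -/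

theorem contMDiff_rotateSphere (m : ℕ)
    (A : EuclideanSpace ℝ (Fin (m + 1)) ≃ₗᵢ[ℝ] EuclideanSpace ℝ (Fin (m + 1))) :
    ContMDiff (cylModel m) (cylModel m) ∞ (rotateSphere m A) := by
  have := Fact.mk (@finrank_euclideanSpace_fin ℝ _ (m + 1))
  refine contMDiff_fst.prodMk ?_
  refine ContMDiff.codRestrict_sphere (f := fun p : Cyl m => A p.2.1) ?_ _
  exact A.contDiff.contMDiff.comp ((contMDiff_coe_sph m).comp contMDiff_snd)

theorem contMDiff_rotateCircle (m : ℕ) (a : Circle) :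
    ContMDiff (cylModel m) (cylModel m) ∞ (rotateCircle m a) :=
  haveI : LieGroup (𝓡 1) ∞ Circle := LieGroup.of_le (n := ω) le_top
  (contMDiff_const.mul contMDiff_fst).prodMk contMDiff_snd

theorem mdifferentiable_coe_fst (m : ℕ) :
    MDifferentiable (cylModel m) 𝓘(ℝ, ℂ) (fun p : Cyl m => (p.1 : ℂ)) :=
  (((contMDiff_coe_circle (n := 1))).comp contMDiff_fst).mdifferentiable one_ne_zero

theorem mdifferentiable_coe_snd (m : ℕ) :
    MDifferentiable (cylModel m) 𝓘(ℝ, EuclideanSpace ℝ (Fin (m + 1)))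
      (fun p : Cyl m => p.2.1) :=
  (((contMDiff_coe_sph m (n := 1))).comp contMDiff_snd).mdifferentiable one_ne_zero

theorem productMetric_apply (T : ℝ) (m : ℕ) (p : Cyl m) (v w : TangentSpace (cylModel m) p) :
    productMetric T m p v w =
      (T / (2 * Real.pi)) ^ 2 *
        inner ℝ (show ℂ from mfderiv (cylModel m) 𝓘(ℝ, ℂ) (fun y : Cyl m => (y.1 : ℂ)) p v)
          (show ℂ from mfderiv (cylModel m) 𝓘(ℝ, ℂ) (fun y : Cyl m => (y.1 : ℂ)) p w)
      + inner ℝ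
          (show EuclideanSpace ℝ (Fin (m + 1)) from mfderiv (cylModel m)
            𝓘(ℝ, EuclideanSpace ℝ (Fin (m + 1))) (fun y : Cyl m => y.2.1) p v)
          (show EuclideanSpace ℝ (Fin (m + 1)) from mfderiv (cylModel m)
            𝓘(ℝ, EuclideanSpace ℝ (Fin (m + 1))) (fun y : Cyl m => y.2.1) p w) := by
  have h := pullback_productMetric_apply T m (mdifferentiableAt_id (I := cylModel m) (x := p)) v w
  refine Eq.trans ?_ h
  simp only [pullback, mfderiv_id]
  rfl

theorem pullback_rotateSphere_productMetric (T : ℝ) (m : ℕ)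
    (A : EuclideanSpace ℝ (Fin (m + 1)) ≃ₗᵢ[ℝ] EuclideanSpace ℝ (Fin (m + 1))) :
    pullback (cylModel m) (cylModel m) (rotateSphere m A) (productMetric T m)
      = productMetric T m := by
  funext p
  refine LinearMap.ext fun v => LinearMap.ext fun w => ?_
  rw [pullback_productMetric_apply T m ((contMDiff_rotateSphere m A).mdifferentiable (by simp) p),
    productMetric_apply]
  have hA : mfderiv (cylModel m) 𝓘(ℝ, EuclideanSpace ℝ (Fin (m + 1)))
      (fun y : Cyl m => (rotateSphere m A y).2.1) p =
      (A : EuclideanSpace ℝ (Fin (m + 1)) →L[ℝ] EuclideanSpace ℝ (Fin (m + 1))).comp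
      (mfderiv (cylModel m) 𝓘(ℝ, EuclideanSpace ℝ (Fin (m + 1))) (fun y : Cyl m => y.2.1) p) := by
    refine (mfderiv_comp (I' := 𝓘(ℝ, EuclideanSpace ℝ (Fin (m + 1)))) (g := A) p
      (A.contDiff.contMDiff.mdifferentiable (n := 1) one_ne_zero _)
      (mdifferentiable_coe_snd m p)).trans ?_
    rw [mfderiv_eq_fderiv]
    congr 1
    exact A.toContinuousLinearEquiv.fderiv
  rw [hA]
  congr 1
  exact A.inner_map_map _ _

theorem pullback_rotateCircle_productMetric (T : ℝ) (m : ℕ) (a : Circle) :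
    pullback (cylModel m) (cylModel m) (rotateCircle m a) (productMetric T m)
      = productMetric T m := by
  funext p
  refine LinearMap.ext fun v => LinearMap.ext fun w => ?_
  rw [pullback_productMetric_apply T m ((contMDiff_rotateCircle m a).mdifferentiable (by simp) p),
    productMetric_apply]
  have hA : mfderiv (cylModel m) 𝓘(ℝ, ℂ) (fun y : Cyl m => ((rotateCircle m a y).1 : ℂ)) p =
      ((rotation a : ℂ ≃ₗᵢ[ℝ] ℂ) : ℂ →L[ℝ] ℂ).comp
      (mfderiv (cylModel m) 𝓘(ℝ, ℂ) (fun y : Cyl m => (y.1 : ℂ)) p) := by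
    refine (mfderiv_comp (I' := 𝓘(ℝ, ℂ)) (g := rotation a) p
      ((rotation a).contDiff.contMDiff.mdifferentiable (n := 1) one_ne_zero _)
      (mdifferentiable_coe_fst m p)).trans ?_
    rw [mfderiv_eq_fderiv]
    congr 1
    exact (rotation a).toContinuousLinearEquiv.fderiv
  rw [hA]
  congr 2
  exact (rotation a).inner_map_map _ _

/-- A vector tangent to the sphere works, whatever `T` is. This is what lets a conformal factor be
recovered from its metric. -/
theorem exists_productMetric_self_ne_zero (T : ℝ) {m : ℕ} (hm : 0 < m) (p : Cyl m) :
    ∃ v, productMetric T m p v v ≠ 0 := by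
  have := Fact.mk (@finrank_euclideanSpace_fin ℝ _ (m + 1))
  let w : EuclideanSpace ℝ (Fin m) := EuclideanSpace.single ⟨0, hm⟩ 1
  have hw : w ≠ 0 := by simp [w]
  let v : TangentSpace (cylModel m) p := ((0 : EuclideanSpace ℝ (Fin 1)), w)
  refine ⟨v, ?_⟩
  rw [productMetric_apply]
  refine (add_pos_of_nonneg_of_pos (mul_nonneg (sq_nonneg _) real_inner_self_nonneg) ?_).ne'
  rw [real_inner_self_pos]
  have e : mfderiv (cylModel m) 𝓘(ℝ, EuclideanSpace ℝ (Fin (m + 1)))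
      (fun y : Cyl m => y.2.1) p =
      (mfderiv (𝓡 m) 𝓘(ℝ, EuclideanSpace ℝ (Fin (m + 1))) (fun ξ : Sph m => ξ.1) p.2).comp
        (mfderiv (cylModel m) (𝓡 m) Prod.snd p) :=
    mfderiv_comp p ((contMDiff_coe_sph m (n := 1)).mdifferentiable one_ne_zero _)
      mdifferentiableAt_snd
  rw [e, mfderiv_snd]
  intro h0
  refine hw (mfderiv_coe_sphere_injective (n := m) p.2 ?_)
  exact h0.trans (map_zero _).symm

theorem smul_productMetric_injective (T : ℝ) {m : ℕ} (hm : 0 < m) (p : Cyl m) {a b : ℝ}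
    (h : a • productMetric T m p = b • productMetric T m p) : a = b := by
  obtain ⟨v, hv⟩ := exists_productMetric_self_ne_zero T hm p
  have := LinearMap.congr_fun (LinearMap.congr_fun h v) v
  exact mul_right_cancel₀ hv this

/-- Pulling back a conformal multiple of a tensor field. -/
theorem pullback_smul_apply {E E' H H' M N : Type*} [NormedAddCommGroup E] [NormedSpace ℝ E]
    [TopologicalSpace H] [TopologicalSpace M] [ChartedSpace H M] [NormedAddCommGroup E']
    [NormedSpace ℝ E'] [TopologicalSpace H'] [TopologicalSpace N] [ChartedSpace H' N]
    (I : ModelWithCorners ℝ E H) (J : ModelWithCorners ℝ E' H') (φ : M → N) (f : N → ℝ)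
    (g : TwoTensor J N) (p : M) :
    pullback I J φ (fun q => f q • g q) p = f (φ p) • pullback I J φ g p := rfl

/-- The reflection in the hyperplane orthogonal to `ξ - η` exchanges the two points. -/
theorem exists_isometry_apply_eq {m : ℕ} (ξ η : Sph m) :
    ∃ A : EuclideanSpace ℝ (Fin (m + 1)) ≃ₗᵢ[ℝ] EuclideanSpace ℝ (Fin (m + 1)), A ξ.1 = η.1 :=
  ⟨_, Submodule.reflection_sub (by simp)⟩

theorem rotationallyInvariant_smul_iff (T : ℝ) {m : ℕ} (hm : 0 < m) (f : Cyl m → ℝ) :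
    RotationallyInvariant m (fun p => f p • productMetric T m p) ↔
      ∀ z ξ η, f (z, ξ) = f (z, η) := by
  constructor
  · intro h z ξ η
    obtain ⟨A, hA⟩ := exists_isometry_apply_eq ξ η
    have h1 := congr_fun (h A) (z, ξ)
    rw [pullback_smul_apply, pullback_rotateSphere_productMetric] at h1
    have h2 := smul_productMetric_injective T hm _ h1
    rw [← h2]
    congr 1
    exact Prod.ext rfl (Subtype.ext hA)
  · intro h A
    funext p
    rw [pullback_smul_apply, pullback_rotateSphere_productMetric]
    exact congr_arg (· • productMetric T m p) (h p.1 _ _)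

theorem equivalent_smul_iff (T : ℝ) {m : ℕ} (hm : 0 < m) (f₁ f₂ : Cyl m → ℝ) :
    Equivalent m (fun p => f₁ p • productMetric T m p) (fun p => f₂ p • productMetric T m p) ↔
      ∃ c : ℝ, 0 < c ∧ ∃ a : Circle, ∀ p, f₁ p = c * f₂ (a * p.1, p.2) := by
  refine exists_congr fun c => and_congr_right fun _ => exists_congr fun a =>
    forall_congr' fun p => ?_
  rw [pullback_smul_apply, pullback_rotateCircle_productMetric, smul_smul]
  exact ⟨smul_productMetric_injective T hm p, fun h => congrArg (· • productMetric T m p) h⟩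

end PseudoCyl

end

noncomputable section

namespace PseudoCyl

/-! ### Stereographic charts -/

section StereoInv

variable {F V : Type*} [NormedAddCommGroup F] [InnerProductSpace ℝ F] [NormedAddCommGroup V]
  [InnerProductSpace ℝ V]

/-- Inverse stereographic projection from `-ξ`, with the hyperplane `ξᗮ` parametrized by `U`. -/
def stereoInv (U : F →ₗᵢ[ℝ] V) (ξ : V) (y : F) : V :=
  (‖y‖ ^ 2 + 4)⁻¹ • ((4 : ℝ) • U y + (4 - ‖y‖ ^ 2) • ξ)

theorem hasFDerivAt_stereoInv (U : F →ₗᵢ[ℝ] V) (ξ : V) (y : F) :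
    HasFDerivAt (stereoInv U ξ)
      ((‖y‖ ^ 2 + 4)⁻¹ • ((4 : ℝ) • U.toContinuousLinearMap
        + (-(2 • innerSL ℝ y)).smulRight ξ)
        + ((-((‖y‖ ^ 2 + 4) ^ 2)⁻¹) • (2 • innerSL ℝ y)).smulRight
            ((4 : ℝ) • U y + (4 - ‖y‖ ^ 2) • ξ)) y := by
  have h0 : ‖y‖ ^ 2 + 4 ≠ 0 := by positivity
  have h1 : HasFDerivAt (fun z : F => ‖z‖ ^ 2) (2 • innerSL ℝ y) y :=
    (hasStrictFDerivAt_norm_sq y).hasFDerivAt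
  have h2 := (hasDerivAt_inv h0).comp_hasFDerivAt y (h1.add_const 4)
  have h3 := (U.toContinuousLinearMap.hasFDerivAt (x := y)).const_smul (4 : ℝ)
  have h4 := (h1.const_sub 4).smul_const ξ
  exact h2.fun_smul (h3.add h4)

/-- Conformality of stereographic projection, which makes the product metric diagonal in the charts.
-/
theorem inner_fderiv_stereoInv {U : F →ₗᵢ[ℝ] V} {ξ : V} (hξ : ‖ξ‖ = 1)
    (hU : ∀ y, inner ℝ (U y) ξ = 0) (y v w : F) :
    inner ℝ (fderiv ℝ (stereoInv U ξ) y v) (fderiv ℝ (stereoInv U ξ) y w)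
      = stereoFactor y * inner ℝ v w := by
  have h0 : ‖y‖ ^ 2 + 4 ≠ 0 := by positivity
  have hU' : ∀ y, inner ℝ ξ (U y) = 0 := fun y => by rw [real_inner_comm, hU]
  rw [(hasFDerivAt_stereoInv U ξ y).fderiv]
  have hy : inner ℝ y y = ‖y‖ ^ 2 := real_inner_self_eq_norm_sq y
  simp [inner_add_left, inner_add_right, inner_smul_left, inner_smul_right, hU, hU',
    real_inner_comm y, hξ]
  rw [stereoFactor]
  field_simp
  ring

end StereoInv

/-- The preferred chart at `ξ` projects from `-ξ`; `U` comes from the orthonormal basis of the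
orthogonal hyperplane that the chart uses. -/
theorem exists_extChartAt_symm_sphere {V : Type*} [NormedAddCommGroup V] [InnerProductSpace ℝ V]
    {n : ℕ} [Fact (Module.finrank ℝ V = n + 1)] (ξ : Metric.sphere (0 : V) 1) :
    ∃ U : EuclideanSpace ℝ (Fin n) →ₗᵢ[ℝ] V, (∀ y, inner ℝ (U y) ξ.1 = 0) ∧
      ∀ y, ((extChartAt (𝓡 n) ξ).symm y).1 = stereoInv U ξ.1 y := by
  let R : (Submodule.span ℝ {((-ξ : Metric.sphere (0 : V) 1) : V)})ᗮ ≃ₗᵢ[ℝ] _ :=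
    (OrthonormalBasis.fromOrthogonalSpanSingleton n
      (ne_zero_of_mem_unit_sphere (-ξ))).repr
  refine ⟨(Submodule.subtypeₗᵢ _).comp R.symm.toLinearIsometry, fun y => ?_, fun y => ?_⟩
  · have := Submodule.mem_orthogonal_singleton_iff_inner_left.1 (R.symm y).2
    have h : inner ℝ ((R.symm y : _) : V) (-ξ.1) = 0 := this
    rw [inner_neg_right, neg_eq_zero] at h
    exact h
  · have h := stereographic'_symm_apply (-ξ) y
    have h2 : ((extChartAt (𝓡 n) ξ).symm y) = (stereographic' n (-ξ)).symm y := by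
      simp [extChartAt, chartAt, ChartedSpace.chartAt]
    rw [h2, h]
    have h3 : ‖((R.symm y : _) : V)‖ = ‖y‖ := R.symm.norm_map y
    change (‖((R.symm y : _) : V)‖ ^ 2 + 4)⁻¹ • (4 : ℝ) • ((R.symm y : _) : V) +
      (‖((R.symm y : _) : V)‖ ^ 2 + 4)⁻¹ • (‖((R.symm y : _) : V)‖ ^ 2 - 4) • (-ξ.1)  = _
    rw [h3, stereoInv, smul_add, smul_neg, ← neg_smul, neg_sub]
    rfl

theorem extChartAt_sphere_target {V : Type*} [NormedAddCommGroup V] [InnerProductSpace ℝ V]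
    {n : ℕ} [Fact (Module.finrank ℝ V = n + 1)] (ξ : Metric.sphere (0 : V) 1) :
    (extChartAt (𝓡 n) ξ).target = Set.univ := by
  have : (chartAt (EuclideanSpace ℝ (Fin n)) ξ).target = Set.univ := stereographic'_target (-ξ)
  simp [extChartAt, this]

theorem extChartAt_sphere_self {V : Type*} [NormedAddCommGroup V] [InnerProductSpace ℝ V]
    {n : ℕ} [Fact (Module.finrank ℝ V = n + 1)] (ξ : Metric.sphere (0 : V) 1) :
    extChartAt (𝓡 n) ξ ξ = 0 := by
  have h : extChartAt (𝓡 n) ξ ξ = stereographic' n (-ξ) ξ := rfl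
  rw [h, stereographic']
  simp only [OpenPartialHomeomorph.coe_trans, Function.comp_apply]
  have h2 := stereographic_neg_apply ξ
  erw [h2]
  exact map_zero (OrthonormalBasis.fromOrthogonalSpanSingleton n
    (ne_zero_of_mem_unit_sphere (-ξ))).repr

theorem cyl_extChartAt_target {m : ℕ} (p : Cyl m) :
    (extChartAt (cylModel m) p).target = Set.univ := by
  have := finrank_real_complex_fact'
  have := Fact.mk (@finrank_euclideanSpace_fin ℝ _ (m + 1))
  rw [extChartAt_prod, PartialEquiv.prod_target]
  have h1 := extChartAt_sphere_target (n := 1) (V := ℂ) p.1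
  have h2 := extChartAt_sphere_target (n := m) p.2
  rw [h2]
  erw [h1]
  simp

theorem cyl_extChartAt_self {m : ℕ} (p : Cyl m) : extChartAt (cylModel m) p p = 0 := by
  have := finrank_real_complex_fact'
  have := Fact.mk (@finrank_euclideanSpace_fin ℝ _ (m + 1))
  have h1 := extChartAt_sphere_self (n := 1) (V := ℂ) p.1
  have h2 := extChartAt_sphere_self (n := m) p.2
  rw [extChartAt_prod]
  exact Prod.ext h1 h2

theorem exists_cyl_extChartAt_symm {m : ℕ} (p : Cyl m) :
    ∃ (U₁ : EuclideanSpace ℝ (Fin 1) →ₗᵢ[ℝ] ℂ)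
      (U₂ : EuclideanSpace ℝ (Fin m) →ₗᵢ[ℝ] EuclideanSpace ℝ (Fin (m + 1))),
      (∀ y, inner ℝ (U₁ y) (p.1 : ℂ) = 0) ∧ (∀ y, inner ℝ (U₂ y) p.2.1 = 0) ∧
      ∀ x, (((extChartAt (cylModel m) p).symm x).1 : ℂ) = stereoInv U₁ p.1 x.1 ∧
        ((extChartAt (cylModel m) p).symm x).2.1 = stereoInv U₂ p.2.1 x.2 := by
  have := finrank_real_complex_fact'
  have := Fact.mk (@finrank_euclideanSpace_fin ℝ _ (m + 1))
  obtain ⟨U₁, h1, h1'⟩ := exists_extChartAt_symm_sphere (n := 1) (V := ℂ) p.1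
  obtain ⟨U₂, h2, h2'⟩ := exists_extChartAt_symm_sphere (n := m) p.2
  refine ⟨U₁, U₂, h1, h2, fun x => ?_⟩
  rw [extChartAt_prod]
  exact ⟨h1' x.1, h2' x.2⟩

theorem eq_single_zero (y : EuclideanSpace ℝ (Fin 1)) : EuclideanSpace.single 0 (y 0) = y := by
  ext i
  obtain rfl : i = 0 := Subsingleton.elim _ _
  simp

theorem metricCoeff_smul_productMetric (T : ℝ) {m : ℕ} (F : Circle → ℝ) (p : Cyl m) :
    metricCoeff (cylModel m) (cylBasis m) (fun q => F q.1 • productMetric T m q) p =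
      warpedCoeff m
        (fun s => (T / (2 * Real.pi)) ^ 2 * (stereoFactor s *
          F ((extChartAt (cylModel m) p).symm (EuclideanSpace.single 0 s, 0)).1))
        (fun s => F ((extChartAt (cylModel m) p).symm (EuclideanSpace.single 0 s, 0)).1) := by
  obtain ⟨U₁, U₂, h1, h2, h⟩ := exists_cyl_extChartAt_symm p
  funext x
  have hφ : MDifferentiableAt
      𝓘(ℝ, EuclideanSpace ℝ (Fin 1) × EuclideanSpace ℝ (Fin m)) (cylModel m)
      (extChartAt (cylModel m) p).symm x := by
    have := contMDiffOn_extChartAt_symm (I := cylModel m) (n := 1) p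
    rw [cyl_extChartAt_target, contMDiffOn_univ] at this
    exact this.mdifferentiable one_ne_zero x
  have hF : F ((extChartAt (cylModel m) p).symm x).1 =
      F ((extChartAt (cylModel m) p).symm (EuclideanSpace.single 0 (x.1 0), 0)).1 := by
    congr 1
    apply Circle.ext
    rw [(h _).1, (h _).1, eq_single_zero]
  have hz : ‖(p.1 : ℂ)‖ = 1 := p.1.norm_coe
  have hξ : ‖p.2.1‖ = 1 := by simp
  have d1 : fderiv ℝ (fun y : EuclideanSpace ℝ (Fin 1) × EuclideanSpace ℝ (Fin m) =>
      stereoInv U₁ (p.1 : ℂ) y.1) x = (fderiv ℝ (stereoInv U₁ (p.1 : ℂ)) x.1).comp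
        (ContinuousLinearMap.fst ℝ _ _) :=
    ((hasFDerivAt_stereoInv U₁ _ _).differentiableAt.hasFDerivAt.comp x hasFDerivAt_fst).fderiv
  have d2 : fderiv ℝ (fun y : EuclideanSpace ℝ (Fin 1) × EuclideanSpace ℝ (Fin m) =>
      stereoInv U₂ p.2.1 y.2) x = (fderiv ℝ (stereoInv U₂ p.2.1) x.2).comp
        (ContinuousLinearMap.snd ℝ _ _) :=
    ((hasFDerivAt_stereoInv U₂ _ _).differentiableAt.hasFDerivAt.comp x hasFDerivAt_snd).fderiv
  have key (v w : EuclideanSpace ℝ (Fin 1) × EuclideanSpace ℝ (Fin m)) :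
      pullback 𝓘(ℝ, EuclideanSpace ℝ (Fin 1) × EuclideanSpace ℝ (Fin m)) (cylModel m)
        (extChartAt (cylModel m) p).symm (fun q => F q.1 • productMetric T m q) x v w =
      F ((extChartAt (cylModel m) p).symm (EuclideanSpace.single 0 (x.1 0), 0)).1 *
        ((T / (2 * Real.pi)) ^ 2 * (stereoFactor x.1 * inner ℝ v.1 w.1)
          + stereoFactor x.2 * inner ℝ v.2 w.2) := by
    rw [pullback_smul_apply _ _ _ (fun q : Cyl m => F q.1), ← hF,
      ← inner_fderiv_stereoInv hz h1, ← inner_fderiv_stereoInv hξ h2]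
    refine congrArg (F ((extChartAt (cylModel m) p).symm x).1 * ·)
      ((pullback_productMetric_apply T m hφ v w).trans ?_)
    simp only [h, mfderiv_eq_fderiv]
    erw [d1, d2]
    rfl
  have hn : stereoFactor x.1 = stereoFactor (x.1 0) := by
    rw [stereoFactor, stereoFactor, ← eq_single_zero x.1]
    simp
  ext i j
  rw [metricCoeff, Matrix.of_apply]
  refine (key _ _).trans ?_
  rw [hn]
  rcases i with i | i <;> rcases j with j | j
  · obtain rfl : i = j := Subsingleton.elim _ _
    simp [cylBasis, warpedCoeff]
    ring
  · simp [cylBasis, warpedCoeff]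
  · simp [cylBasis, warpedCoeff]
  · by_cases hij : i = j
    · subst hij
      simp [cylBasis, warpedCoeff]
    · simp [cylBasis, warpedCoeff, hij, EuclideanSpace.inner_single_left]

/-- The stereographic coordinate on a circle is twice the tangent of half the angle. The sign `ε` is
needed because the chart's unit vector on the tangent line has unspecified orientation. -/
theorem exists_extChartAt_symm_eq_exp {m : ℕ} (θ : ℝ) (ξ : Sph m) :
    ∃ ε : ℝ, ε ^ 2 = 1 ∧ ∀ s : ℝ, ((extChartAt (cylModel m) ((Circle.exp θ, ξ) : Cyl m)).symm
      (EuclideanSpace.single 0 s, 0)).1 = Circle.exp (θ + 2 * Real.arctan (ε * s / 2)) := by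
  obtain ⟨U₁, U₂, h1, h2, h⟩ := exists_cyl_extChartAt_symm ((Circle.exp θ, ξ) : Cyl m)
  set z : ℂ := (Circle.exp θ : ℂ) with hz
  have hz1 : ‖z‖ = 1 := (Circle.exp θ).norm_coe
  set u : ℂ := U₁ (EuclideanSpace.single 0 1) with hu
  have hu1 : ‖u‖ = 1 := by rw [hu, U₁.norm_map]; simp
  have huz : inner ℝ u z = 0 := h1 _
  have hzz : z * (starRingEnd ℂ) z = 1 := by
    rw [Complex.mul_conj, Complex.normSq_eq_norm_sq, hz1]; simp
  -- The unit vector `u` is orthogonal to `z`, so `q = u/z` is `i` or `-i`; its imaginary part is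
  -- the sign.
  set q : ℂ := u * (starRingEnd ℂ) z with hq
  have hq1 : ‖q‖ = 1 := by rw [hq, norm_mul, Complex.norm_conj, hu1, hz1, mul_one]
  have hqre : q.re = 0 := by
    rw [Complex.inner] at huz
    rw [← huz, hq]
    simp
    ring
  have hqim : q.im ^ 2 = 1 := by
    have := Complex.normSq_apply q
    rw [Complex.normSq_eq_norm_sq, hq1, hqre] at this
    linarith
  have hq' : q = q.im * Complex.I := by
    apply Complex.ext <;> simp [hqre]
  have huq : u = q.im * Complex.I * z := by
    rw [← hq', hq, mul_assoc, mul_comm _ z, hzz, mul_one]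
  refine ⟨q.im, hqim, fun s => ?_⟩
  apply Circle.ext
  rw [(h _).1, Circle.exp_add, Circle.coe_mul, stereoInv]
  change _ = z * _
  have hs : U₁ (EuclideanSpace.single 0 s) = s • u := by
    rw [hu, ← map_smul]
    congr 1
    ext i
    obtain rfl : i = 0 := Subsingleton.elim _ _
    simp
  set τ := q.im * s / 2 with hτ
  have hτ2 : τ ^ 2 = s ^ 2 / 4 := by
    rw [hτ, div_pow, mul_pow, hqim]; ring
  have hcos : Real.cos (2 * Real.arctan τ) = (4 - s ^ 2) / (s ^ 2 + 4) := by
    rw [Real.cos_two_mul, Real.cos_sq_arctan, hτ2]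
    field_simp
    ring
  have hsin : Real.sin (2 * Real.arctan τ) = 4 * q.im * s / (s ^ 2 + 4) := by
    have : Real.sin (2 * Real.arctan τ) = 2 * τ * Real.cos (Real.arctan τ) ^ 2 := by
      rw [Real.sin_two_mul, ← Real.tan_mul_cos (Real.cos_arctan_pos τ).ne', Real.tan_arctan]
      ring
    rw [this, Real.cos_sq_arctan, hτ2, hτ]
    field_simp
    ring
  have hexp : (Circle.exp (2 * Real.arctan τ) : ℂ) =
      ((4 - s ^ 2) / (s ^ 2 + 4) : ℝ) + (4 * q.im * s / (s ^ 2 + 4) : ℝ) * Complex.I := by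
    rw [Circle.coe_exp, Complex.exp_mul_I, ← Complex.ofReal_cos, ← Complex.ofReal_sin, hcos, hsin]
  have hn : ‖(EuclideanSpace.single (0 : Fin 1) s : EuclideanSpace ℝ (Fin 1))‖ ^ 2 = s ^ 2 := by
    simp
  have h4 : (s : ℂ) ^ 2 + 4 ≠ 0 := by
    have : (s ^ 2 + 4 : ℝ) ≠ 0 := by positivity
    exact_mod_cast this
  dsimp only
  rw [hexp, hn, hs, huq]
  simp only [Complex.real_smul]
  push_cast
  field_simp
  ring

/-- Arc length `g` as a function of the chart coordinate satisfies `g'(0) = εL`, `g''(0) = 0`. So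
`coordScalar_warped` at the centre sees only `X` and its derivatives; `L` cancels and `ε² = 1`. -/
theorem scalarCurvature_conformal {T : ℝ} (hT : 0 < T) {m : ℕ} (hm : 0 < m) {X X' X'' : ℝ → ℝ}
    (hX0 : ∀ t, 0 < X t) (hX : ∀ t, HasDerivAt X (X' t) t) (hX' : ∀ t, HasDerivAt X' (X'' t) t)
    {F : Circle → ℝ} (hF : ∀ θ, F (Circle.exp θ) = (X (T / (2 * Real.pi) * θ) ^ 2)⁻¹)
    (θ : ℝ) (ξ : Sph m) :
    scalarCurvature (cylModel m) (cylBasis m) (fun q => F q.1 • productMetric T m q)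
      (Circle.exp θ, ξ) =
    (fun t => m * ((m - 1) * X t ^ 2 + 2 * X t * X'' t - (m + 1) * X' t ^ 2))
      (T / (2 * Real.pi) * θ) := by
  rw [scalarCurvature, metricCoeff_smul_productMetric, cyl_extChartAt_self]
  obtain ⟨ε, hε, h⟩ := exists_extChartAt_symm_eq_exp θ ξ
  simp only [h, hF]
  set L := T / (2 * Real.pi) with hL
  have hLpos : 0 < L := by positivity
  let g : ℝ → ℝ := fun s => L * (θ + 2 * Real.arctan (ε * s / 2))
  let g' : ℝ → ℝ := fun s => L * ε * (4 * (s ^ 2 + 4)⁻¹)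
  have hg (s : ℝ) : HasDerivAt g (g' s) s := by
    have h1 : HasDerivAt (fun s => ε * s / 2) (ε / 2) s := by
      simpa using ((hasDerivAt_id s).const_mul ε).div_const 2
    refine ((((Real.hasDerivAt_arctan _).comp s h1).const_mul 2).const_add θ).const_mul L
      |>.congr_deriv ?_
    have : (ε * s / 2) ^ 2 = s ^ 2 / 4 := by rw [div_pow, mul_pow, hε]; ring
    simp only [g', this]
    field_simp
    ring
  have hw (s : ℝ) : HasDerivAt (stereoFactor : ℝ → ℝ) (-64 * s / (s ^ 2 + 4) ^ 3) s := by
    have := (hasFDerivAt_stereoFactor s).hasDerivAt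
    refine this.congr_deriv ?_
    simp
    ring
  let B : ℝ → ℝ := fun s => (X (g s) ^ 2)⁻¹
  let B' : ℝ → ℝ := fun s => -2 * X' (g s) * g' s / X (g s) ^ 3
  have hX0' (s : ℝ) : X s ≠ 0 := (hX0 s).ne'
  have hXg (s : ℝ) : HasDerivAt (fun s => X (g s)) (X' (g s) * g' s) s := (hX _).comp s (hg s)
  have hX'g (s : ℝ) : HasDerivAt (fun s => X' (g s)) (X'' (g s) * g' s) s := (hX' _).comp s (hg s)
  have hB (s : ℝ) : HasDerivAt B (B' s) s := by
    refine (((hXg s).fun_pow 2).fun_inv (pow_ne_zero 2 (hX0' _))).congr_deriv ?_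
    have := hX0' (g s)
    simp only [B']
    field_simp
    norm_num
    ring
  have hA (s : ℝ) : HasDerivAt (fun s => L ^ 2 * (stereoFactor s * B s))
      (L ^ 2 * (-64 * s / (s ^ 2 + 4) ^ 3 * B s + stereoFactor s * B' s)) s :=
    ((hw s).fun_mul (hB s)).const_mul _
  have hg' : HasDerivAt g' 0 0 := by
    have h1 : HasDerivAt (fun s : ℝ => s ^ 2 + 4) 0 0 := by
      simpa using ((hasDerivAt_id (0 : ℝ)).fun_pow 2).add_const 4
    refine (((h1.fun_inv (by norm_num)).const_mul 4).const_mul (L * ε)).congr_deriv ?_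
    simp
  have hB' := (((hX'g 0).const_mul (-2)).fun_mul hg').fun_div ((hXg 0).fun_pow 3)
    (pow_ne_zero 3 (hX0' _))
  have hBpos (s : ℝ) : 0 < B s := inv_pos.2 (pow_pos (hX0 _) 2)
  rw [coordScalar_warped (B := B) hA hB
    (fun s => mul_pos (pow_pos hLpos 2) (mul_pos (stereoFactor_pos s) (hBpos s))) hBpos hm hB']
  have hg0 : g 0 = L * θ := by simp [g]
  have hg0' : g' 0 = L * ε := by simp [g']
  have hs0 : stereoFactor (0 : ℝ) = 1 := by norm_num [stereoFactor]
  simp only [B, B', hg0, hg0', hs0]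
  have hx := hX0' (L * θ)
  have hL0 := hLpos.ne'
  generalize X (L * θ) = x at *
  generalize X' (L * θ) = x' at *
  generalize X'' (L * θ) = x'' at *
  have hε3 : ε ^ 2 = 1 := hε
  field_simp
  ring_nf
  simp only [hε3]
  ring

end PseudoCyl

end

noncomputable section

namespace PseudoCyl

/-! ### The potential of the equation `x'' = x - x ^ (N + 1)` -/

/-- The negative right-hand side of `x'' = x - x ^ (N + 1)`. -/
def force (N : ℕ) (x : ℝ) : ℝ := x ^ (N + 1) - x

/-- The potential of `x'' = x - x ^ (N + 1)`, normalized to vanish at the equilibrium `1`. -/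
def potential (N : ℕ) (x : ℝ) : ℝ := x ^ (N + 2) / (N + 2) - x ^ 2 / 2 + N / (2 * (N + 2))

/-- The quotient `potential / (x - 1) ^ 2`, up to a factor `2 (N + 2)`. -/
def potentialQuot (N : ℕ) (x : ℝ) : ℝ :=
  ∑ i ∈ Finset.range N, (2 * ∑ l ∈ Finset.range (i + 2), x ^ l - 1)

/-- The quotient `potential / force ^ 2`, with its singularity at `1` removed. -/
def chicone (N : ℕ) (x : ℝ) : ℝ :=
  potentialQuot N x / (2 * (N + 2) * (x * ∑ i ∈ Finset.range N, x ^ i) ^ 2)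

variable {N : ℕ} {x : ℝ}

theorem hasDerivAt_potential (N : ℕ) (x : ℝ) : HasDerivAt (potential N) (force N x) x := by
  have h1 := ((hasDerivAt_pow (N + 2) x).div_const ((N : ℝ) + 2)).sub
    ((hasDerivAt_pow 2 x).div_const 2)
  refine (h1.add_const (N / (2 * (N + 2) : ℝ))).congr_deriv ?_
  have : (N : ℝ) + 2 ≠ 0 := by positivity
  rw [force]
  push_cast
  field_simp

theorem geom_pos (hN : 1 ≤ N) (hx : 0 < x) : 0 < ∑ i ∈ Finset.range N, x ^ i :=
  Finset.sum_pos (fun i _ => pow_pos hx i) (Finset.nonempty_range_iff.2 (by omega))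

theorem force_eq (N : ℕ) (x : ℝ) :
    force N x = (x - 1) * (x * ∑ i ∈ Finset.range N, x ^ i) := by
  have := geom_sum_mul x N
  rw [force, pow_succ]
  linear_combination (-x) * this

theorem potentialQuot_pos (hN : 1 ≤ N) (hx : 0 < x) : 0 < potentialQuot N x := by
  refine Finset.sum_pos (fun i _ => ?_) (Finset.nonempty_range_iff.2 (by omega))
  have : 1 ≤ ∑ l ∈ Finset.range (i + 2), x ^ l := by
    have := Finset.single_le_sum (f := fun l => x ^ l) (s := Finset.range (i + 2))
      (fun l _ => (pow_pos hx l).le) (Finset.mem_range.2 (show 0 < i + 2 by omega))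
    simpa using this
  linarith

/-- The potential has a double zero at `1`; it is divided out by using the geometric sum twice. -/
theorem potentialQuot_mul (N : ℕ) (x : ℝ) :
    potentialQuot N x * (x - 1) ^ 2 = 2 * (N + 2) * potential N x := by
  have h1 (i : ℕ) : (2 * ∑ l ∈ Finset.range (i + 2), x ^ l - 1) * (x - 1) =
      2 * (x ^ 2 * x ^ i) - (x + 1) := by
    have := geom_sum_mul x (i + 2)
    rw [pow_add] at this
    linear_combination 2 * this
  have h2 : potentialQuot N x * (x - 1) =
      2 * (x ^ 2 * ∑ i ∈ Finset.range N, x ^ i) - N * (x + 1) := by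
    rw [potentialQuot, Finset.sum_mul, Finset.sum_congr rfl fun i _ => h1 i]
    simp [Finset.mul_sum]
    ring
  have h3 := geom_sum_mul x N
  have : (N : ℝ) + 2 ≠ 0 := by positivity
  rw [potential, pow_add]
  field_simp
  linear_combination (x - 1) * h2 + 2 * x ^ 2 * h3

theorem chicone_mul_force_sq (hN : 1 ≤ N) (hx : 0 < x) :
    chicone N x * force N x ^ 2 = potential N x := by
  have h := potentialQuot_mul N x
  have h1 := geom_pos hN hx
  have : (N : ℝ) + 2 ≠ 0 := by positivity
  rw [chicone, force_eq]
  field_simp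
  linear_combination h

theorem chicone_pos (hN : 1 ≤ N) (hx : 0 < x) : 0 < chicone N x := by
  have := geom_pos hN hx
  have := potentialQuot_pos hN hx
  unfold chicone
  positivity

theorem chicone_one (hN : 1 ≤ N) : chicone N 1 = 1 / (2 * N) := by
  have hN' : (N : ℝ) ≠ 0 := by positivity
  have h : potentialQuot N 1 = N * (N + 2) := by
    have h0 : ∀ n : ℕ, ∑ i ∈ Finset.range n, (2 * ((i : ℝ) + 2) - 1) = n * (n + 2) := by
      intro n
      induction n with
      | zero => simp
      | succ n ih => rw [Finset.sum_range_succ, ih]; push_cast; ring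
    simp [potentialQuot, ← h0]
  have : (N : ℝ) + 2 ≠ 0 := by positivity
  rw [chicone, h]
  simp
  field_simp

theorem contDiffAt_chicone (hN : 1 ≤ N) (hx : 0 < x) : ContDiffAt ℝ ∞ (chicone N) x := by
  have := geom_pos hN hx
  unfold chicone potentialQuot
  refine ContDiffAt.div ?_ ?_ (by positivity)
  · fun_prop
  · fun_prop

/-! ### Convexity of `potential / force ^ 2` -/

/-- `3 F' ^ 2 - F F''` for `F = force`. -/
def chiconeB (N : ℕ) (x : ℝ) : ℝ :=
  3 * ((N + 1) * x ^ N - 1) ^ 2 - N * (N + 1) * x ^ N * (x ^ N - 1)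

/-- Let `z = x^N`. For `z < 1` the subtracted term is negative. For `z ≥ 1` the square is at least
`(Nz)²`, while the subtracted term is at most `2(Nz)²`. -/
theorem chiconeB_pos (hN : 1 ≤ N) (hx : 0 < x) : 0 < chiconeB N x := by
  have hz : 0 < x ^ N := pow_pos hx N
  have hN' : (1 : ℝ) ≤ N := by exact_mod_cast hN
  unfold chiconeB
  generalize x ^ N = z at *
  generalize (N : ℝ) = n at *
  rcases lt_or_ge z 1 with h | h
  · have : 0 < n * (n + 1) * z * (1 - z) := by
      have := sub_pos.2 h; positivity
    nlinarith [sq_nonneg ((n + 1) * z - 1)]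
  · have h1 : n * z ≤ (n + 1) * z - 1 := by linarith
    have h2 : (n * z) ^ 2 ≤ ((n + 1) * z - 1) ^ 2 := pow_le_pow_left₀ (by positivity) h1 2
    have h3 : n * (n + 1) * z * (z - 1) ≤ n * (2 * n) * z * z := by
      gcongr <;> linarith
    have : 0 < (n * z) ^ 2 := by positivity
    nlinarith

theorem hasDerivAt_pow_div (hx : 0 < x) : HasDerivAt (fun x : ℝ => x ^ N) (N * x ^ N / x) x := by
  refine (hasDerivAt_pow N x).congr_deriv ?_
  rcases N with _ | N
  · simp
  · have := hx.ne'
    rw [pow_succ]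
    field_simp
    simp

theorem force_eq' (N : ℕ) (x : ℝ) : force N x = x * (x ^ N - 1) := by
  rw [force, pow_succ]; ring

theorem potential_eq' (N : ℕ) (x : ℝ) :
    potential N x = x ^ 2 * (x ^ N / (N + 2) - 1 / 2) + N / (2 * (N + 2)) := by
  rw [potential, pow_add]; ring

theorem hasDerivAt_force (hx : 0 < x) : HasDerivAt (force N) ((N + 1) * x ^ N - 1) x := by
  rw [show force N = fun x => x * (x ^ N - 1) from funext (force_eq' N)]
  refine ((hasDerivAt_id' x).fun_mul ((hasDerivAt_pow_div (N := N) hx).sub_const 1)).congr_deriv ?_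
  have := hx.ne'
  field_simp
  ring

/-- `V - 3 F ^ 2 F' / (2 B)`, whose sign governs the convexity of `V / F ^ 2`. -/
def chiconeY (N : ℕ) (x : ℝ) : ℝ :=
  potential N x - 3 * force N x ^ 2 * ((N + 1) * x ^ N - 1) / (2 * chiconeB N x)

theorem hasDerivAt_chiconeB (hx : 0 < x) : HasDerivAt (chiconeB N)
    ((6 * ((N + 1) * x ^ N - 1) * (N + 1) - N * (N + 1) * (2 * x ^ N - 1)) * (N * x ^ N / x)) x := by
  have hz := hasDerivAt_pow_div (N := N) hx
  have h1 := (((hz.const_mul ((N : ℝ) + 1)).sub_const 1).fun_pow 2).const_mul 3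
  have h2 := ((hz.const_mul ((N : ℝ) * (N + 1)))).fun_mul (hz.sub_const 1)
  refine (h1.fun_sub h2).congr_deriv ?_
  simp
  ring

theorem hasDerivAt_chiconeY (hN : 1 ≤ N) (hx : 0 < x) : HasDerivAt (chiconeY N)
    (force N x ^ 3 * (N * (N + 1) * x ^ N * ((N + 1) * (2 * N + 3) * x ^ N + 3 * (N - 1)) / x ^ 2)
      / (2 * chiconeB N x ^ 2)) x := by
  have hz := hasDerivAt_pow_div (N := N) hx
  have hB := (chiconeB_pos hN hx).ne'
  have h1 := (((hasDerivAt_force (N := N) hx).fun_pow 2).const_mul 3).fun_mul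
    ((hz.const_mul ((N : ℝ) + 1)).sub_const 1)
  have h2 := h1.fun_div ((hasDerivAt_chiconeB hx).const_mul 2) (mul_ne_zero two_ne_zero hB)
  refine ((hasDerivAt_potential N x).fun_sub h2).congr_deriv ?_
  have hx' := hx.ne'
  have e : (2 * (chiconeB N x)) ≠ 0 := mul_ne_zero two_ne_zero hB
  rw [force_eq']
  field_simp
  rw [chiconeB]
  simp only [Nat.reduceSub, pow_one, Nat.cast_ofNat]
  ring

/-- The function vanishes at `1`, and its derivative is `force³` times a positive factor, hence has
the sign of `x - 1`. -/
theorem chiconeY_pos (hN : 1 ≤ N) (hx : 0 < x) (hx1 : x ≠ 1) : 0 < chiconeY N x := by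
  have hN' : (1 : ℝ) ≤ N := by exact_mod_cast hN
  have h1 : chiconeY N 1 = 0 := by
    have : (N : ℝ) + 2 ≠ 0 := by positivity
    simp [chiconeY, force, potential]
    field_simp
    ring
  have hpos : ∀ y : ℝ, 0 < y → 0 < (N * (N + 1) * y ^ N *
      ((N + 1) * (2 * N + 3) * y ^ N + 3 * (N - 1)) / y ^ 2) / (2 * chiconeB N y ^ 2) := by
    intro y hy
    have := chiconeB_pos hN hy
    have : (0 : ℝ) ≤ N - 1 := by linarith
    positivity
  have hcont : ∀ y : ℝ, 0 < y → ContinuousAt (chiconeY N) y := fun y hy =>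
    (hasDerivAt_chiconeY hN hy).continuousAt
  rcases lt_or_gt_of_ne hx1 with h | h
  · have : StrictAntiOn (chiconeY N) (Set.Icc x 1) := by
      refine strictAntiOn_of_deriv_neg (convex_Icc x 1)
        (fun y hy => (hcont y (hx.trans_le hy.1)).continuousWithinAt) fun y hy => ?_
      rw [interior_Icc] at hy
      have hy0 : 0 < y := hx.trans hy.1
      rw [(hasDerivAt_chiconeY hN hy0).deriv, mul_div_assoc]
      refine mul_neg_of_neg_of_pos ?_ (hpos y hy0)
      rw [force_eq]
      refine Odd.pow_neg (by decide) (mul_neg_of_neg_of_pos (by linarith [hy.2]) ?_)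
      exact mul_pos hy0 (geom_pos hN hy0)
    have := this (Set.left_mem_Icc.2 h.le) (Set.right_mem_Icc.2 h.le) h
    linarith
  · have : StrictMonoOn (chiconeY N) (Set.Icc 1 x) := by
      refine strictMonoOn_of_deriv_pos (convex_Icc 1 x)
        (fun y hy => (hcont y (one_pos.trans_le hy.1)).continuousWithinAt) fun y hy => ?_
      rw [interior_Icc] at hy
      have hy0 : 0 < y := one_pos.trans hy.1
      rw [(hasDerivAt_chiconeY hN hy0).deriv, mul_div_assoc]
      refine mul_pos ?_ (hpos y hy0)
      rw [force_eq]
      exact pow_pos (mul_pos (by linarith [hy.1]) (mul_pos hy0 (geom_pos hN hy0))) 3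
    have := this (Set.left_mem_Icc.2 h.le) (Set.right_mem_Icc.2 h.le) h
    linarith

theorem force_ne_zero (hN : 1 ≤ N) (hx : 0 < x) (hx1 : x ≠ 1) : force N x ≠ 0 := by
  rw [force_eq]
  exact mul_ne_zero (sub_ne_zero.2 hx1) (mul_pos hx (geom_pos hN hx)).ne'

theorem hasDerivAt_chicone_of_ne (hN : 1 ≤ N) (hx : 0 < x) (hx1 : x ≠ 1) :
    HasDerivAt (chicone N)
      ((force N x ^ 2 - 2 * potential N x * ((N + 1) * x ^ N - 1)) / force N x ^ 3) x := by
  have hF := force_ne_zero hN hx hx1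
  have h1 := (hasDerivAt_potential N x).fun_div ((hasDerivAt_force (N := N) hx).fun_pow 2)
    (pow_ne_zero 2 hF)
  refine (h1.congr_deriv ?_).congr_of_eventuallyEq ?_
  · field_simp
    simp
    ring
  · filter_upwards [lt_mem_nhds hx, isOpen_ne.mem_nhds hx1] with y hy hy1
    rw [eq_div_iff (pow_ne_zero 2 (force_ne_zero hN hy hy1)), chicone_mul_force_sq hN hy]

/-- With `B = 3F'² - FF''`, differentiating `V/F²` twice gives `(2BV - 3F²F')/F⁴`; factoring out
`2B` leaves `chiconeY`, whose derivative no longer contains `V`. -/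
theorem hasDerivAt_deriv_chicone_of_ne (hN : 1 ≤ N) (hx : 0 < x) (hx1 : x ≠ 1) :
    HasDerivAt (deriv (chicone N)) (2 * chiconeB N x * chiconeY N x / force N x ^ 4) x := by
  have hF := force_ne_zero hN hx hx1
  have hz := hasDerivAt_pow_div (N := N) hx
  have h0 := ((hz.const_mul ((N : ℝ) + 1)).sub_const 1)
  have h1 := ((((hasDerivAt_force (N := N) hx).fun_pow 2)).fun_sub
    (((hasDerivAt_potential N x).const_mul 2).fun_mul h0)).fun_div
    ((hasDerivAt_force (N := N) hx).fun_pow 3) (pow_ne_zero 3 hF)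
  refine (h1.congr_deriv ?_).congr_of_eventuallyEq ?_
  · have hB := (chiconeB_pos hN hx).ne'
    have hx' := hx.ne'
    rw [chiconeY]
    have hE : 2 * chiconeB N x * (potential N x - 3 * force N x ^ 2 * ((N + 1) * x ^ N - 1) /
      (2 * chiconeB N x)) = 2 * chiconeB N x * potential N x
        - 3 * force N x ^ 2 * ((N + 1) * x ^ N - 1) := by field_simp
    rw [hE]
    field_simp
    simp only [Nat.reduceSub, pow_one, Nat.cast_ofNat]
    have hFx : x ^ N - 1 = force N x / x := by rw [force_eq']; field_simp
    rw [chiconeB, hFx]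
    field_simp
    ring
  · filter_upwards [lt_mem_nhds hx, isOpen_ne.mem_nhds hx1] with y hy hy1
    exact (hasDerivAt_chicone_of_ne hN hy hy1).deriv

theorem differentiableAt_chicone (hN : 1 ≤ N) (hx : 0 < x) : DifferentiableAt ℝ (chicone N) x :=
  (contDiffAt_chicone hN hx).differentiableAt (by simp)

theorem continuousAt_deriv_chicone (hN : 1 ≤ N) (hx : 0 < x) :
    ContinuousAt (deriv (chicone N)) x := by
  have h : ContDiffOn ℝ ∞ (chicone N) (Set.Ioi 0) := fun y hy =>
    (contDiffAt_chicone hN hy).contDiffWithinAt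
  exact (h.continuousOn_deriv_of_isOpen isOpen_Ioi (by simp)).continuousAt (Ioi_mem_nhds hx)

/-- The formula for the second derivative is singular at `1`, so the two sides are treated
separately and joined by continuity of the first derivative. -/
theorem strictMonoOn_deriv_chicone (hN : 1 ≤ N) :
    StrictMonoOn (deriv (chicone N)) (Set.Ioi 0) := by
  have hcont := fun (y : ℝ) (hy : 0 < y) => continuousAt_deriv_chicone hN hy
  have hpos : ∀ y : ℝ, 0 < y → y ≠ 1 → 0 < deriv (deriv (chicone N)) y := by
    intro y hy hy1
    rw [(hasDerivAt_deriv_chicone_of_ne hN hy hy1).deriv]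
    have := chiconeB_pos hN hy
    have := chiconeY_pos hN hy hy1
    have := (Even.pow_pos (n := 4) (by decide) (force_ne_zero hN hy hy1))
    positivity
  have h1 : StrictMonoOn (deriv (chicone N)) (Set.Ioc 0 1) := by
    refine strictMonoOn_of_deriv_pos (convex_Ioc 0 1)
        (fun y hy => (hcont y hy.1).continuousWithinAt) fun y hy => ?_
    rw [interior_Ioc] at hy
    exact hpos y hy.1 hy.2.ne
  have h2 : StrictMonoOn (deriv (chicone N)) (Set.Ici 1) := by
    refine strictMonoOn_of_deriv_pos (convex_Ici 1)
        (fun y hy => (hcont y (one_pos.trans_le hy)).continuousWithinAt) fun y hy => ?_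
    rw [interior_Ici] at hy
    exact hpos y (one_pos.trans hy) (ne_of_gt hy)
  have := h1.union h2 (c := 1) ⟨by simp, fun y hy => hy.2⟩ ⟨by simp, fun y hy => hy⟩
  rwa [Set.Ioc_union_Ici_eq_Ioi one_pos] at this

end PseudoCyl

end

noncomputable section

namespace PseudoCyl

variable {N : ℕ} {x s ρ : ℝ}

/-! ### The signed square root of the potential and its inverse -/

/-- The signed square root of the potential. -/
def phase (N : ℕ) (x : ℝ) : ℝ := force N x * √(chicone N x)

theorem phase_sq (hN : 1 ≤ N) (hx : 0 < x) : phase N x ^ 2 = potential N x := by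
  rw [phase, mul_pow, Real.sq_sqrt (chicone_pos hN hx).le, mul_comm, chicone_mul_force_sq hN hx]

theorem phase_one (N : ℕ) : phase N 1 = 0 := by simp [phase, force]

/-- This is the derivative of `W F² = V` divided by `F`; at `x = 1` it rests on `W(1) = 1/(2N)`. It
reduces the derivative of the phase to `1/(2√W)`. -/
theorem two_mul_force_deriv_add (hN : 1 ≤ N) (hx : 0 < x) :
    2 * ((N + 1) * x ^ N - 1) * chicone N x + force N x * deriv (chicone N) x = 1 := by
  have hN' : (N : ℝ) ≠ 0 := by positivity
  by_cases hx1 : x = 1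
  · subst hx1
    rw [chicone_one hN]
    simp [force]
    field_simp
  · have hF := force_ne_zero hN hx hx1
    rw [(hasDerivAt_chicone_of_ne hN hx hx1).deriv, ← chicone_mul_force_sq hN hx]
    field_simp
    ring

theorem hasDerivAt_phase (hN : 1 ≤ N) (hx : 0 < x) :
    HasDerivAt (phase N) (2 * √(chicone N x))⁻¹ x := by
  have hW := chicone_pos hN hx
  have h1 := (hasDerivAt_force (N := N) hx).fun_mul
    ((differentiableAt_chicone hN hx).hasDerivAt.sqrt hW.ne')
  refine h1.congr_deriv ?_
  have h2 := two_mul_force_deriv_add hN hx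
  have h3 := Real.sqrt_pos.2 hW
  have h4 := Real.sq_sqrt hW.le
  field_simp
  rw [h4]
  linear_combination h2

theorem strictMonoOn_phase (hN : 1 ≤ N) : StrictMonoOn (phase N) (Set.Ioi 0) := by
  refine strictMonoOn_of_deriv_pos (convex_Ioi 0)
    (fun y hy => (hasDerivAt_phase hN hy).continuousAt.continuousWithinAt) fun y hy => ?_
  rw [interior_Ioi] at hy
  rw [(hasDerivAt_phase hN hy).deriv]
  have := chicone_pos hN hy
  positivity

/-- The range of the phase. -/
def phaseRange (N : ℕ) : Set ℝ := phase N '' Set.Ioi 0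

/-- The inverse of the phase. -/
def phaseInv (N : ℕ) : ℝ → ℝ := Function.invFunOn (phase N) (Set.Ioi 0)

theorem phase_mem (hx : 0 < x) : phase N x ∈ phaseRange N := ⟨x, hx, rfl⟩

theorem phaseInv_pos (hs : s ∈ phaseRange N) : 0 < phaseInv N s :=
  Function.invFunOn_mem hs

theorem phase_phaseInv (hs : s ∈ phaseRange N) : phase N (phaseInv N s) = s :=
  Function.invFunOn_eq hs

theorem phaseInv_phase (hN : 1 ≤ N) (hx : 0 < x) : phaseInv N (phase N x) = x :=
  (strictMonoOn_phase hN).injOn (phaseInv_pos (phase_mem hx)) hx (phase_phaseInv (phase_mem hx))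

theorem ordConnected_phaseRange (hN : 1 ≤ N) : (phaseRange N).OrdConnected :=
  (isPreconnected_Ioi.image _ fun _ hy =>
    (hasDerivAt_phase hN hy).continuousAt.continuousWithinAt).ordConnected

theorem phaseRange_mem_nhds (hN : 1 ≤ N) (hs : s ∈ phaseRange N) : phaseRange N ∈ nhds s := by
  obtain ⟨x, hx, rfl⟩ := hs
  have hx : 0 < x := hx
  refine Filter.mem_of_superset (Icc_mem_nhds ?_ ?_)
    ((ordConnected_phaseRange hN).out (phase_mem (half_pos hx)) (phase_mem (x := 2 * x) (by linarith)))
  · exact strictMonoOn_phase hN (half_pos hx) hx (half_lt_self hx)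
  · exact strictMonoOn_phase hN hx (Set.mem_Ioi.2 (by linarith)) (by linarith)

theorem strictMonoOn_phaseInv (hN : 1 ≤ N) : StrictMonoOn (phaseInv N) (phaseRange N) := by
  intro a ha b hb hab
  rw [← (strictMonoOn_phase hN).lt_iff_lt (phaseInv_pos ha) (phaseInv_pos hb), phase_phaseInv ha,
    phase_phaseInv hb]
  exact hab

theorem continuousAt_phaseInv (hN : 1 ≤ N) (hs : s ∈ phaseRange N) :
    ContinuousAt (phaseInv N) s := by
  refine (strictMonoOn_phaseInv hN).continuousAt_of_image_mem_nhds (phaseRange_mem_nhds hN hs) ?_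
  refine Filter.mem_of_superset (Ioi_mem_nhds (phaseInv_pos hs)) fun x hx => ?_
  exact ⟨phase N x, phase_mem hx, phaseInv_phase hN hx⟩

/-- The derivative of `phaseInv`, up to a factor `2`. -/
def speed (N : ℕ) (s : ℝ) : ℝ := √(chicone N (phaseInv N s))

theorem speed_pos (hN : 1 ≤ N) (hs : s ∈ phaseRange N) : 0 < speed N s :=
  Real.sqrt_pos.2 (chicone_pos hN (phaseInv_pos hs))

theorem hasDerivAt_phaseInv (hN : 1 ≤ N) (hs : s ∈ phaseRange N) :
    HasDerivAt (phaseInv N) (2 * speed N s) s := by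
  have h := speed_pos hN hs
  refine (HasDerivAt.of_local_left_inverse (continuousAt_phaseInv hN hs)
    (hasDerivAt_phase hN (phaseInv_pos hs)) (inv_ne_zero (mul_pos two_pos h).ne')
    ?_).congr_deriv (inv_inv _)
  filter_upwards [phaseRange_mem_nhds hN hs] with y hy using phase_phaseInv hy

/-- The factor `1/(2√W)` from the square root cancels `dx/ds = 2√W`. Hence convexity in `s` follows
from monotonicity of `W'` in `x`. -/
theorem hasDerivAt_speed (hN : 1 ≤ N) (hs : s ∈ phaseRange N) :
    HasDerivAt (speed N) (deriv (chicone N) (phaseInv N s)) s := by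
  have hx := phaseInv_pos hs
  have h1 := ((differentiableAt_chicone hN hx).hasDerivAt.comp s
    (hasDerivAt_phaseInv hN hs)).sqrt (chicone_pos hN hx).ne'
  refine h1.congr_deriv ?_
  have h := speed_pos hN hs
  rw [speed] at h
  simp only [Function.comp_apply, speed]
  field_simp

theorem strictConvexOn_speed (hN : 1 ≤ N) : StrictConvexOn ℝ (phaseRange N) (speed N) := by
  have ho : interior (phaseRange N) = phaseRange N :=
    (isOpen_iff_mem_nhds.2 fun _ hs => phaseRange_mem_nhds hN hs).interior_eq
  refine StrictMonoOn.strictConvexOn_of_deriv (ordConnected_phaseRange hN).convex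
    (fun s hs => (hasDerivAt_speed hN hs).continuousAt.continuousWithinAt) ?_
  rw [ho]
  intro a ha b hb hab
  rw [(hasDerivAt_speed hN ha).deriv, (hasDerivAt_speed hN hb).deriv]
  exact strictMonoOn_deriv_chicone hN (phaseInv_pos ha) (phaseInv_pos hb)
    (strictMonoOn_phaseInv hN ha hb hab)

/-- The amplitudes of the periodic orbits around the equilibrium. -/
def amplitudes (N : ℕ) : Set ℝ := {ρ | 0 ≤ ρ ∧ ρ ∈ phaseRange N ∧ -ρ ∈ phaseRange N}

theorem mem_phaseRange_of_abs_le (hN : 1 ≤ N) (hρ : ρ ∈ amplitudes N) (hs : |s| ≤ ρ) :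
    s ∈ phaseRange N :=
  (ordConnected_phaseRange hN).out hρ.2.2 hρ.2.1 ⟨(abs_le.1 hs).1, (abs_le.1 hs).2⟩

theorem abs_mul_cos_le (hρ : 0 ≤ ρ) (θ : ℝ) : |ρ * Real.cos θ| ≤ ρ := by
  rw [abs_mul, abs_of_nonneg hρ]
  exact mul_le_of_le_one_right hρ (Real.abs_cos_le_one θ)

theorem mul_cos_mem (hN : 1 ≤ N) (hρ : ρ ∈ amplitudes N) (θ : ℝ) :
    ρ * Real.cos θ ∈ phaseRange N :=
  mem_phaseRange_of_abs_le hN hρ (abs_mul_cos_le hρ.1 θ)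

theorem mem_amplitudes_of_le (hN : 1 ≤ N) {ρ' : ℝ} (hρ : ρ ∈ amplitudes N) (h0 : 0 ≤ ρ')
    (h : ρ' ≤ ρ) : ρ' ∈ amplitudes N :=
  ⟨h0, mem_phaseRange_of_abs_le hN hρ (by rwa [abs_of_nonneg h0]),
    mem_phaseRange_of_abs_le hN hρ (by rwa [abs_neg, abs_of_nonneg h0])⟩

theorem zero_mem_amplitudes (N : ℕ) : 0 ∈ amplitudes N := by
  have : (0 : ℝ) ∈ phaseRange N := ⟨1, Set.mem_Ioi.2 one_pos, phase_one N⟩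
  exact ⟨le_rfl, this, by simpa⟩

/-- Both `a` and `-a` are convex combinations of `b` and `-b`, with exchanged weights; the two
strict convexity inequalities are added. -/
theorem speed_add_speed_neg_lt (hN : 1 ≤ N) {a b : ℝ} (hb : b ∈ amplitudes N) (hab : |a| < b) :
    speed N a + speed N (-a) < speed N b + speed N (-b) := by
  have hb0 : 0 < b := (abs_nonneg a).trans_lt hab
  obtain ⟨h1, h2⟩ := abs_lt.1 hab
  have hc := strictConvexOn_speed hN
  have hne : b ≠ -b := by linarith
  have hl : 0 < (b + a) / (2 * b) := div_pos (by linarith) (by linarith)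
  have hr : 0 < (b - a) / (2 * b) := div_pos (by linarith) (by linarith)
  have hsum : (b + a) / (2 * b) + (b - a) / (2 * b) = 1 := by field_simp; ring
  have e1 := hc.2 hb.2.1 hb.2.2 hne hl hr hsum
  have e2 := hc.2 hb.2.1 hb.2.2 hne hr hl (by rw [add_comm]; exact hsum)
  simp only [smul_eq_mul] at e1 e2
  rw [show (b + a) / (2 * b) * b + (b - a) / (2 * b) * -b = a by field_simp; ring] at e1
  rw [show (b - a) / (2 * b) * b + (b + a) / (2 * b) * -b = -a by field_simp; ring] at e2
  have e3 : (b - a) / (2 * b) = 1 - (b + a) / (2 * b) := by linarith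
  rw [e3] at e1 e2
  nlinarith

/-! ### The period function -/

/-- The time at which the orbit of amplitude `ρ` reaches the angle `θ`. -/
def orbitTime (N : ℕ) (ρ θ : ℝ) : ℝ := ∫ φ in (0 : ℝ)..θ, √2 * speed N (ρ * Real.cos φ)

/-- The period of the orbit of amplitude `ρ`. -/
def period (N : ℕ) (ρ : ℝ) : ℝ := orbitTime N ρ (2 * Real.pi)

theorem continuous_speed_mul_cos (hN : 1 ≤ N) (hρ : ρ ∈ amplitudes N) :
    Continuous fun φ => speed N (ρ * Real.cos φ) := by
  refine continuous_iff_continuousAt.2 fun φ => ?_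
  exact ContinuousAt.comp (f := fun φ => ρ * Real.cos φ)
    (hasDerivAt_speed hN (mul_cos_mem hN hρ φ)).continuousAt (by fun_prop)

theorem hasDerivAt_orbitTime (hN : 1 ≤ N) (hρ : ρ ∈ amplitudes N) (θ : ℝ) :
    HasDerivAt (orbitTime N ρ) (√2 * speed N (ρ * Real.cos θ)) θ := by
  have h : Continuous fun φ => √2 * speed N (ρ * Real.cos φ) :=
    (continuous_speed_mul_cos hN hρ).const_mul _
  exact intervalIntegral.integral_hasDerivAt_right (h.intervalIntegrable _ _)
    h.aestronglyMeasurable.stronglyMeasurableAtFilter h.continuousAt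

theorem orbitTime_add_period (hN : 1 ≤ N) (hρ : ρ ∈ amplitudes N) (θ : ℝ) :
    orbitTime N ρ (θ + 2 * Real.pi) = orbitTime N ρ θ + period N ρ := by
  have h : Continuous fun φ => √2 * speed N (ρ * Real.cos φ) :=
    (continuous_speed_mul_cos hN hρ).const_mul _
  have hp : Function.Periodic (fun φ => √2 * speed N (ρ * Real.cos φ)) (2 * Real.pi) := fun φ => by
    simp
  rw [orbitTime, ← intervalIntegral.integral_add_adjacent_intervals (h.intervalIntegrable 0 θ)
    (h.intervalIntegrable _ _), hp.intervalIntegral_add_eq θ 0, zero_add]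
  rfl

/-- At amplitude `0` the orbit is constant, but the integral still has a value: the period of the
linearization at `1`. -/
theorem period_zero (hN : 1 ≤ N) : period N 0 = 2 * Real.pi / √N := by
  have h1 : phaseInv N 0 = 1 := by rw [← phase_one N, phaseInv_phase hN one_pos]
  have hN' : (0 : ℝ) < N := by positivity
  simp only [period, orbitTime, zero_mul, speed, h1, chicone_one hN]
  rw [intervalIntegral.integral_const, ← Real.sqrt_mul zero_le_two]
  rw [show (2 : ℝ) * (1 / (2 * N)) = (N : ℝ)⁻¹ by field_simp, Real.sqrt_inv]
  simp [div_eq_mul_inv]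

/-- The shift `φ ↦ φ + π` changes the sign of the cosine; this symmetrization makes the integrand
pointwise monotone in the amplitude. -/
theorem two_mul_period (hN : 1 ≤ N) (hρ : ρ ∈ amplitudes N) :
    2 * period N ρ = √2 * ∫ φ in (0 : ℝ)..2 * Real.pi,
      (speed N (ρ * Real.cos φ) + speed N (-(ρ * Real.cos φ))) := by
  have h := continuous_speed_mul_cos hN hρ
  have h' : Continuous fun φ => speed N (-(ρ * Real.cos φ)) := by
    have := h.comp (continuous_add_const Real.pi)
    simpa [Function.comp_def] using this
  have e : ∫ φ in (0 : ℝ)..2 * Real.pi, speed N (-(ρ * Real.cos φ)) =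
      ∫ φ in (0 : ℝ)..2 * Real.pi, speed N (ρ * Real.cos φ) := by
    have hp : Function.Periodic (fun φ => speed N (ρ * Real.cos φ)) (2 * Real.pi) := fun φ => by
      simp
    have h2 := intervalIntegral.integral_comp_add_right
      (fun φ => speed N (ρ * Real.cos φ)) Real.pi (a := 0) (b := 2 * Real.pi)
    simp only [Real.cos_add_pi, mul_neg] at h2
    rw [h2, show 2 * Real.pi + Real.pi = (0 + Real.pi) + 2 * Real.pi by ring,
      hp.intervalIntegral_add_eq (0 + Real.pi) 0, zero_add]
  rw [intervalIntegral.integral_add (h.intervalIntegrable _ _) (h'.intervalIntegrable _ _), e,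
    period, orbitTime, intervalIntegral.integral_const_mul]
  ring

theorem strictMonoOn_period (hN : 1 ≤ N) : StrictMonoOn (period N) (amplitudes N) := by
  intro a ha b hb hab
  suffices h : 2 * period N a < 2 * period N b by linarith
  have hcont {ρ : ℝ} (hρ : ρ ∈ amplitudes N) :
      Continuous fun φ => speed N (ρ * Real.cos φ) + speed N (-(ρ * Real.cos φ)) := by
    have h := continuous_speed_mul_cos hN hρ
    have := h.comp (continuous_add_const Real.pi)
    refine h.add ?_
    simpa [Function.comp_def] using this
  have key (φ : ℝ) (hφ : Real.cos φ ≠ 0) :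
      speed N (a * Real.cos φ) + speed N (-(a * Real.cos φ)) <
      speed N (b * Real.cos φ) + speed N (-(b * Real.cos φ)) := by
    have h1 : |a * Real.cos φ| < |b * Real.cos φ| := by
      rw [abs_mul, abs_mul, abs_of_nonneg ha.1, abs_of_nonneg hb.1]
      exact mul_lt_mul_of_pos_right hab (abs_pos.2 hφ)
    have h2 := speed_add_speed_neg_lt hN
      (mem_amplitudes_of_le hN hb (abs_nonneg _) (abs_mul_cos_le hb.1 φ)) h1
    rcases abs_choice (b * Real.cos φ) with h3 | h3 <;> rw [h3] at h2
    · exact h2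
    · rw [neg_neg] at h2
      linarith
  rw [two_mul_period hN ha, two_mul_period hN hb]
  refine mul_lt_mul_of_pos_left ?_ (by positivity)
  refine intervalIntegral.integral_lt_integral_of_continuousOn_of_le_of_exists_lt Real.two_pi_pos
    (hcont ha).continuousOn (hcont hb).continuousOn (fun φ _ => ?_)
    ⟨0, ⟨le_rfl, Real.two_pi_pos.le⟩, key 0 (by simp)⟩
  by_cases hφ : Real.cos φ = 0
  · simp [hφ]
  · exact (key φ hφ).le

theorem continuousOn_period (hN : 1 ≤ N) (hρ : ρ ∈ amplitudes N) :
    ContinuousOn (period N) (Set.Icc 0 ρ) := by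
  have hle : -ρ ≤ ρ := by linarith [hρ.1]
  -- `speed` is known to be continuous only on the phase range, so it is extended by constants from
  -- `[-ρ, ρ]` to obtain a jointly continuous integrand.
  let k : ℝ → ℝ := Set.IccExtend hle ((Set.Icc (-ρ) ρ).domRestrict (speed N))
  have hk : Continuous k := by
    refine Continuous.Icc_extend' (continuousOn_iff_continuous_domRestrict.1 fun s hs => ?_)
    exact (hasDerivAt_speed hN (mem_phaseRange_of_abs_le hN hρ
      (abs_le.2 hs))).continuousAt.continuousWithinAt
  have hc : Continuous fun r : ℝ => ∫ φ in (0 : ℝ)..2 * Real.pi, √2 * k (r * Real.cos φ) := by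
    refine intervalIntegral.continuous_parametric_intervalIntegral_of_continuous' ?_ _ _
    exact (hk.comp (by fun_prop : Continuous fun p : ℝ × ℝ => p.1 * Real.cos p.2)).const_mul _
  refine hc.continuousOn.congr fun r hr => ?_
  refine intervalIntegral.integral_congr fun φ _ => ?_
  have h1 : r * Real.cos φ ∈ Set.Icc (-ρ) ρ :=
    abs_le.1 ((abs_mul_cos_le hr.1 φ).trans hr.2)
  simp only [k]
  rw [Set.IccExtend_of_mem hle _ h1]
  rfl

end PseudoCyl

end

noncomputable section

namespace PseudoCyl

variable {N : ℕ} {ρ : ℝ}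

/-! ### Solutions of `x'' = x - x ^ (N + 1)` -/

/-- `X` is a positive solution of `x'' = x - x ^ (N + 1)`, with derivative `X'`. -/
structure IsSol (N : ℕ) (X X' : ℝ → ℝ) : Prop where
  pos : ∀ t, 0 < X t
  deriv : ∀ t, HasDerivAt X (X' t) t
  deriv' : ∀ t, HasDerivAt X' (-force N (X t)) t

theorem IsSol.energy {X X' : ℝ → ℝ} (h : IsSol N X X') (s t : ℝ) :
    X' s ^ 2 / 2 + potential N (X s) = X' t ^ 2 / 2 + potential N (X t) := by
  have hd (r : ℝ) : HasDerivAt (fun r => X' r ^ 2 / 2 + potential N (X r)) 0 r := by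
    refine ((((h.deriv' r).fun_pow 2).div_const 2).fun_add
      ((hasDerivAt_potential N (X r)).comp r (h.deriv r))).congr_deriv ?_
    simp
    ring
  exact is_const_of_deriv_eq_zero (fun r => (hd r).differentiableAt) (fun r => (hd r).deriv) s t

theorem IsSol.comp_add {X X' : ℝ → ℝ} (h : IsSol N X X') (a : ℝ) :
    IsSol N (fun t => X (t + a)) (fun t => X' (t + a)) :=
  ⟨fun _ => h.pos _, fun t => (h.deriv _).comp_add_const t a,
    fun t => (h.deriv' _).comp_add_const t a⟩

theorem isSol_one (N : ℕ) : IsSol N (fun _ => 1) (fun _ => 0) :=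
  ⟨fun _ => one_pos, fun _ => hasDerivAt_const _ _, fun t => by
    simpa [force] using hasDerivAt_const t (0 : ℝ)⟩

/-- The vector field is only locally Lipschitz, so local uniqueness is made global by showing that
the coincidence set is clopen. -/
theorem IsSol.ext {X X' Z Z' : ℝ → ℝ} (h : IsSol N X X') (hz : IsSol N Z Z') (h0 : X 0 = Z 0)
    (h1 : X' 0 = Z' 0) : X = Z := by
  let v : ℝ → ℝ × ℝ → ℝ × ℝ := fun _ p => (p.2, -force N p.1)
  have hv : ContDiff ℝ 1 (v 0) := by
    simp only [v, force]
    fun_prop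
  let f : ℝ → ℝ × ℝ := fun t => (X t, X' t)
  let g : ℝ → ℝ × ℝ := fun t => (Z t, Z' t)
  have hf (t : ℝ) : HasDerivAt f (v t (f t)) t := (h.deriv t).prodMk (h.deriv' t)
  have hg (t : ℝ) : HasDerivAt g (v t (g t)) t := (hz.deriv t).prodMk (hz.deriv' t)
  have hfc : Continuous f := continuous_iff_continuousAt.2 fun t => (hf t).continuousAt
  have hgc : Continuous g := continuous_iff_continuousAt.2 fun t => (hg t).continuousAt
  have hclopen : IsClopen {t | f t = g t} := by
    refine ⟨isClosed_eq hfc hgc, isOpen_iff_mem_nhds.2 fun t ht => ?_⟩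
    obtain ⟨K, s, hs, hK⟩ := (hv.contDiffAt (x := f t)).exists_lipschitzOnWith
    refine ODE_solution_unique_of_eventually (v := v) (s := fun _ => s) (K := K)
      (Filter.Eventually.of_forall fun _ => hK) ?_ ?_ ht
    · filter_upwards [hfc.continuousAt hs] with r hr using ⟨hf r, hr⟩
    · have hs' : s ∈ nhds (g t) := by rw [← show f t = g t from ht]; exact hs
      filter_upwards [hgc.continuousAt hs'] with r hr using ⟨hg r, hr⟩
  have huniv := hclopen.eq_univ ⟨0, Prod.ext h0 h1⟩
  funext t
  have : t ∈ {t | f t = g t} := huniv ▸ Set.mem_univ t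
  exact congrArg Prod.fst this

/-! ### The periodic orbits -/

theorem orbitTime_strictMono (hN : 1 ≤ N) (hρ : ρ ∈ amplitudes N) :
    StrictMono (orbitTime N ρ) :=
  strictMono_of_deriv_pos fun θ => by
    rw [(hasDerivAt_orbitTime hN hρ θ).deriv]
    have := speed_pos hN (mul_cos_mem hN hρ θ)
    positivity

theorem orbitTime_zero (N : ℕ) (ρ : ℝ) : orbitTime N ρ 0 = 0 := by simp [orbitTime]

theorem period_pos (hN : 1 ≤ N) (hρ : ρ ∈ amplitudes N) : 0 < period N ρ := by
  have := orbitTime_strictMono hN hρ Real.two_pi_pos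
  rwa [orbitTime_zero] at this

theorem orbitTime_int_mul (hN : 1 ≤ N) (hρ : ρ ∈ amplitudes N) (n : ℤ) :
    orbitTime N ρ (n * (2 * Real.pi)) = n * period N ρ := by
  induction n with
  | zero => simp [orbitTime_zero]
  | succ i ih =>
    push_cast at ih ⊢
    rw [add_mul, one_mul, orbitTime_add_period hN hρ, ih]
    ring
  | pred i ih =>
    have := orbitTime_add_period hN hρ (((-(i : ℤ) - 1 : ℤ) : ℝ) * (2 * Real.pi))
    push_cast at ih this ⊢
    rw [show (-(i : ℝ) - 1) * (2 * Real.pi) + 2 * Real.pi = -(i : ℝ) * (2 * Real.pi) by ring,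
      ih] at this
    linarith

theorem orbitTime_surjective (hN : 1 ≤ N) (hρ : ρ ∈ amplitudes N) :
    Function.Surjective (orbitTime N ρ) := by
  intro t
  have hc : Continuous (orbitTime N ρ) :=
    continuous_iff_continuousAt.2 fun θ => (hasDerivAt_orbitTime hN hρ θ).continuousAt
  obtain ⟨n, hn⟩ := Archimedean.arch |t| (period_pos hN hρ)
  rw [nsmul_eq_mul] at hn
  refine mem_range_of_exists_le_of_exists_ge hc ⟨((-n : ℤ) : ℝ) * (2 * Real.pi), ?_⟩
    ⟨((n : ℤ) : ℝ) * (2 * Real.pi), ?_⟩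
  · rw [orbitTime_int_mul hN hρ]
    push_cast
    linarith [neg_abs_le t]
  · rw [orbitTime_int_mul hN hρ]
    push_cast
    linarith [le_abs_self t]

/-- `X` is the solution which starts at rest from its maximum, of amplitude `ρ`. -/
structure IsOrbit (N : ℕ) (ρ : ℝ) (X X' : ℝ → ℝ) : Prop extends IsSol N X X' where
  zero : X 0 = phaseInv N ρ
  zero' : X' 0 = 0
  periodic : Function.Periodic X (period N ρ)
  eq_zero : 0 < ρ → ∀ t, X t = X 0 → ∃ j : ℤ, t = j * period N ρ
  exists_min : ∃ t ∈ Set.Icc 0 (period N ρ), X t = phaseInv N (-ρ)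

/-- The energy level `X'²/2 + V = ρ²` is a circle in suitable coordinates: phase `ρ cos θ`, velocity
`-√2 ρ sin θ`. The angle as a function of time is the inverse of `orbitTime`. -/
theorem exists_isOrbit (hN : 1 ≤ N) (hρ : ρ ∈ amplitudes N) : ∃ X X', IsOrbit N ρ X X' := by
  let e : ℝ ≃o ℝ := (orbitTime_strictMono hN hρ).orderIsoOfSurjective _
    (orbitTime_surjective hN hρ)
  have he (t : ℝ) : orbitTime N ρ (e.symm t) = t := e.apply_symm_apply t
  have he' (θ : ℝ) : e.symm (orbitTime N ρ θ) = θ := e.symm_apply_apply θ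
  have h0 : e.symm 0 = 0 := by simpa only [orbitTime_zero] using he' 0
  have hmem (t : ℝ) := mul_cos_mem hN hρ (e.symm t)
  have hsp (t : ℝ) := speed_pos hN (hmem t)
  have h20 : √2 ≠ (0 : ℝ) := by positivity
  have hΘ (t : ℝ) : HasDerivAt e.symm (√2 * speed N (ρ * Real.cos (e.symm t)))⁻¹ t := by
    refine HasDerivAt.of_local_left_inverse e.symm.continuous.continuousAt
      (hasDerivAt_orbitTime hN hρ _) (mul_pos (by positivity) (hsp t)).ne'
      (Filter.Eventually.of_forall he)
  refine ⟨fun t => phaseInv N (ρ * Real.cos (e.symm t)),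
    fun t => -√2 * ρ * Real.sin (e.symm t), ⟨fun t => phaseInv_pos (hmem t), fun t => ?_,
    fun t => ?_⟩, ?_, ?_, ?_, ?_, ?_⟩
  · refine ((hasDerivAt_phaseInv hN (hmem t)).comp t ((hΘ t).cos.const_mul ρ)).congr_deriv ?_
    have := (hsp t).ne'
    field_simp
    rw [Real.sq_sqrt zero_le_two]
    ring
  · refine ((hΘ t).sin.const_mul (-√2 * ρ)).congr_deriv ?_
    have h3 := phase_phaseInv (hmem t)
    have h4 := (hsp t).ne'
    rw [phase] at h3
    change force N _ * speed N _ = _ at h3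
    field_simp
    linear_combination h3
  · simp [h0]
  · simp [h0]
  · intro t
    have : e.symm (t + period N ρ) = e.symm t + 2 * Real.pi := by
      rw [← he' (e.symm t + 2 * Real.pi), orbitTime_add_period hN hρ, he]
    simp only [this, Real.cos_add_two_pi]
  · intro hρ0 t ht
    have h3 := (strictMonoOn_phaseInv hN).injOn (hmem t) (hmem 0) ht
    rw [h0, Real.cos_zero] at h3
    obtain ⟨j, hj⟩ := (Real.cos_eq_one_iff _).1 (mul_left_cancel₀ hρ0.ne' h3)
    refine ⟨j, ?_⟩
    rw [← orbitTime_int_mul hN hρ, hj, he]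
  · refine ⟨orbitTime N ρ Real.pi, ⟨?_, ?_⟩, ?_⟩
    · rw [← orbitTime_zero N ρ]
      exact (orbitTime_strictMono hN hρ).monotone Real.pi_pos.le
    · exact (orbitTime_strictMono hN hρ).monotone (by linarith [Real.pi_pos])
    · simp [he']

/-! ### The range of the period function -/

theorem potential_lt_zero (hN : 1 ≤ N) {x : ℝ} (hx : 0 < x) (hx1 : x ≤ 1) :
    potential N x < N / (2 * (N + 2)) := by
  have hN' : (1 : ℝ) ≤ N := by exact_mod_cast hN
  have h1 : x ^ N ≤ 1 := pow_le_one₀ hx.le hx1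
  have h2 : x ^ N / (N + 2) - 1 / 2 < 0 := by
    rw [sub_neg, div_lt_div_iff₀ (by linarith) two_pos]
    linarith
  rw [potential_eq']
  have := mul_neg_of_pos_of_neg (pow_pos hx 2) h2
  linarith

theorem phase_nonneg_iff (hN : 1 ≤ N) {x : ℝ} (hx : 0 < x) : 0 ≤ phase N x ↔ 1 ≤ x := by
  rw [← phase_one N]
  exact (strictMonoOn_phase hN).le_iff_le (Set.mem_Ioi.2 one_pos) hx

theorem phase_nonpos_iff (hN : 1 ≤ N) {x : ℝ} (hx : 0 < x) : phase N x ≤ 0 ↔ x ≤ 1 := by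
  rw [← phase_one N]
  exact (strictMonoOn_phase hN).le_iff_le hx (Set.mem_Ioi.2 one_pos)

/-- The energy lies below `N/(2(N+2))`, the potential at `0`. This yields `X'² ≤ X²`, so `log X + t`
is nondecreasing, and the descent from a maximum at least `1` to the minimum takes time at least
`-log` of the minimum. -/
theorem neg_log_le_period (hN : 1 ≤ N) (hρ : ρ ∈ amplitudes N) :
    -Real.log (phaseInv N (-ρ)) ≤ period N ρ := by
  obtain ⟨X, X', h⟩ := exists_isOrbit hN hρ
  obtain ⟨t₁, ⟨ht0, htP⟩, ht⟩ := h.exists_min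
  have hmin := phaseInv_pos hρ.2.2
  have hmin1 : phaseInv N (-ρ) ≤ 1 := by
    rw [← phase_nonpos_iff hN hmin, phase_phaseInv hρ.2.2]
    linarith [hρ.1]
  have hmax1 : 1 ≤ phaseInv N ρ := by
    rw [← phase_nonneg_iff hN (phaseInv_pos hρ.2.1), phase_phaseInv hρ.2.1]
    exact hρ.1
  have hE : potential N (phaseInv N ρ) < N / (2 * (N + 2)) := by
    have := potential_lt_zero hN hmin hmin1
    rw [← phase_sq hN (phaseInv_pos hρ.2.2), phase_phaseInv hρ.2.2] at this
    rw [← phase_sq hN (phaseInv_pos hρ.2.1), phase_phaseInv hρ.2.1]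
    linarith
  have hbound (t : ℝ) : -X t ≤ X' t := by
    have h1 := h.energy t 0
    rw [h.zero, h.zero'] at h1
    rw [potential] at h1
    have h2 : 0 < X t ^ (N + 2) / (N + 2) := by
      have := h.pos t
      positivity
    have h3 : X' t ^ 2 ≤ X t ^ 2 := by linarith
    exact (abs_le.1 (abs_le_of_sq_le_sq h3 (h.pos t).le)).1
  have hmono : Monotone fun t => Real.log (X t) + t := by
    have hd (t : ℝ) : HasDerivAt (fun t => Real.log (X t) + t) (X' t / X t + 1) t :=
      ((h.deriv t).log (h.pos t).ne').fun_add (hasDerivAt_id' t)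
    refine monotone_of_deriv_nonneg (fun t => (hd t).differentiableAt) fun t => ?_
    rw [(hd t).deriv, div_add_one (h.pos t).ne']
    exact div_nonneg (by linarith [hbound t]) (h.pos t).le
  have h1 := hmono ht0
  simp only [ht, h.zero, add_zero] at h1
  have := Real.log_nonneg hmax1
  linarith

theorem exists_period_eq (hN : 1 ≤ N) {P : ℝ} (hP : 2 * Real.pi / √N < P) :
    ∃ ρ ∈ amplitudes N, 0 < ρ ∧ period N ρ = P := by
  have hP0 : 0 < P := lt_of_le_of_lt (by positivity) hP
  -- With this value as minimum, `neg_log_le_period` gives a period of at least `P`.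
  set ε := Real.exp (-P) with hε
  have hε0 : 0 < ε := Real.exp_pos _
  have hε1 : ε < 1 := by rw [hε, Real.exp_lt_one_iff]; linarith
  have h1 : phase N ε < 0 := by
    rw [← phase_one N]
    exact strictMonoOn_phase hN hε0 (Set.mem_Ioi.2 one_pos) hε1
  -- The opposite turning point must exist on the right of `1`: the potential at `2` is at least the
  -- potential at `0`, which exceeds the one at `ε`.
  have h2 : -phase N ε ≤ phase N 2 := by
    have h3 : 0 ≤ phase N 2 := (phase_nonneg_iff hN two_pos).2 one_le_two
    refine le_of_sq_le_sq ?_ h3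
    rw [neg_sq, phase_sq hN hε0, phase_sq hN two_pos]
    refine (potential_lt_zero hN hε0 hε1.le).le.trans ?_
    rw [potential_eq']
    have h4 : (N : ℝ) + 2 ≤ 2 * 2 ^ N := by
      have : N + 1 ≤ 2 ^ N := Nat.lt_two_pow_self
      have : (N : ℝ) + 1 ≤ 2 ^ N := by exact_mod_cast this
      have : (1 : ℝ) ≤ N := by exact_mod_cast hN
      linarith
    have : (1 : ℝ) / 2 ≤ 2 ^ N / (N + 2) := by
      rw [div_le_div_iff₀ two_pos (by positivity)]
      linarith
    linarith
  have hρ : -phase N ε ∈ amplitudes N := by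
    refine ⟨by linarith, ?_, by rw [neg_neg]; exact phase_mem hε0⟩
    exact (ordConnected_phaseRange hN).out (zero_mem_amplitudes N).2.1 (phase_mem two_pos)
      ⟨by linarith, h2⟩
  have hP1 : P ≤ period N (-phase N ε) := by
    have := neg_log_le_period hN hρ
    rwa [neg_neg, phaseInv_phase hN hε0, hε, Real.log_exp, neg_neg] at this
  obtain ⟨r, hr, hrP⟩ := intermediate_value_Icc hρ.1 (continuousOn_period hN hρ)
    ⟨by rw [period_zero hN]; exact hP.le, hP1⟩
  refine ⟨r, mem_amplitudes_of_le hN hρ hr.1 hr.2, ?_, hrP⟩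
  refine lt_of_le_of_ne hr.1 fun h => ?_
  rw [← h, period_zero hN] at hrP
  exact hP.ne hrP

theorem lt_period (hN : 1 ≤ N) (hρ : ρ ∈ amplitudes N) (h0 : 0 < ρ) :
    2 * Real.pi / √N < period N ρ := by
  rw [← period_zero hN]
  exact strictMonoOn_period hN (zero_mem_amplitudes N) hρ h0

end PseudoCyl

end

noncomputable section

namespace PseudoCyl

variable {N : ℕ} {ρ T : ℝ}

/-! ### Classification of the periodic solutions -/

theorem IsOrbit.unique {X X' Z Z' : ℝ → ℝ} (h : IsOrbit N ρ X X') (hz : IsOrbit N ρ Z Z') :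
    X = Z :=
  h.toIsSol.ext hz.toIsSol (h.zero.trans hz.zero.symm) (h.zero'.trans hz.zero'.symm)

theorem exists_forall_ge_of_periodic {X : ℝ → ℝ} (hc : Continuous X) (hT : 0 < T)
    (hp : Function.Periodic X T) : ∃ t₀, ∀ t, X t₀ ≤ X t := by
  obtain ⟨t₀, -, h⟩ := isCompact_Icc.exists_isMinOn
    (Set.nonempty_Icc.2 hT.le) hc.continuousOn (s := Set.Icc 0 T)
  refine ⟨t₀, fun t => ?_⟩
  obtain ⟨s, hs, hst⟩ := hp.exists_mem_Ico₀ hT t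
  rw [hst]
  exact h (Set.Ico_subset_Icc_self hs)

theorem IsSol.continuous {X X' : ℝ → ℝ} (h : IsSol N X X') : Continuous X :=
  continuous_iff_continuousAt.2 fun t => (h.deriv t).continuousAt

/-- Energy is purely potential at both extrema, so their phases agree up to sign. If they are equal,
the solution is constant, hence the equilibrium `1` with phase `0`. -/
theorem IsSol.exists_max_min (hN : 1 ≤ N) {X X' : ℝ → ℝ} (h : IsSol N X X') (hT : 0 < T)
    (hp : Function.Periodic X T) :
    ∃ t₀ t₁, X' t₀ = 0 ∧ X' t₁ = 0 ∧ (∀ t, X t ≤ X t₀) ∧ (∀ t, X t₁ ≤ X t) ∧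
      phase N (X t₁) = -phase N (X t₀) := by
  obtain ⟨t₁, h₁⟩ := exists_forall_ge_of_periodic h.continuous hT hp
  obtain ⟨t₀, h₀⟩ := exists_forall_ge_of_periodic h.continuous.neg hT
    (X := fun t => -X t) (fun t => congrArg Neg.neg (hp t))
  have h₀ (t : ℝ) : X t ≤ X t₀ := neg_le_neg_iff.1 (h₀ t)
  have d₁ : X' t₁ = 0 :=
    IsLocalMin.hasDerivAt_eq_zero (Filter.Eventually.of_forall h₁) (h.deriv t₁)
  have d₀ : X' t₀ = 0 :=
    IsLocalMax.hasDerivAt_eq_zero (Filter.Eventually.of_forall h₀) (h.deriv t₀)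
  refine ⟨t₀, t₁, d₀, d₁, h₀, h₁, ?_⟩
  have hE := h.energy t₁ t₀
  rw [d₀, d₁, ← phase_sq hN (h.pos _), ← phase_sq hN (h.pos _)] at hE
  rcases sq_eq_sq_iff_eq_or_eq_neg.1 (add_left_cancel hE) with h2 | h2
  · have h3 : X t₁ = X t₀ := (strictMonoOn_phase hN).injOn (h.pos _) (h.pos _) h2
    have hconst : X = fun _ => X t₀ := funext fun t => le_antisymm (h₀ t) (h3 ▸ h₁ t)
    have hX' : X' = fun _ => 0 := funext fun t => by
      have := h.deriv t
      rw [hconst] at this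
      exact this.unique (hasDerivAt_const _ _)
    have := h.deriv' t₀
    rw [hX'] at this
    have hF := this.unique (hasDerivAt_const _ _)
    have h1 : X t₀ = 1 := by
      by_contra hne
      exact force_ne_zero hN (h.pos t₀) hne (neg_eq_zero.1 hF)
    rw [h3, h1, phase_one, neg_zero]
  · exact h2

theorem IsSol.eq_one_or_orbit (hN : 1 ≤ N) {X X' : ℝ → ℝ} (h : IsSol N X X') (hT : 0 < T)
    (hp : Function.Periodic X T) :
    (X = fun _ => 1) ∨ ∃ t₀, ∃ ρ ∈ amplitudes N, 0 < ρ ∧ (∃ j : ℕ, 0 < j ∧ T = j * period N ρ) ∧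
      ∀ Z Z', IsOrbit N ρ Z Z' → ∀ t, X t = Z (t + t₀) := by
  obtain ⟨t₀, t₁, d₀, d₁, h₀, h₁, hph⟩ := h.exists_max_min hN hT hp
  have hle : phase N (X t₁) ≤ phase N (X t₀) :=
    (strictMonoOn_phase hN).monotoneOn (h.pos _) (h.pos _) (h₁ t₀)
  have hρ0 : 0 ≤ phase N (X t₀) := by linarith
  have hρ : phase N (X t₀) ∈ amplitudes N :=
    ⟨hρ0, phase_mem (h.pos _), hph ▸ phase_mem (h.pos _)⟩
  rcases hρ0.eq_or_lt with h0 | h0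
  · left
    have e0 : X t₀ = 1 := (strictMonoOn_phase hN).injOn (h.pos _) (Set.mem_Ioi.2 one_pos)
      (h0.symm.trans (phase_one N).symm)
    have e1 : X t₁ = 1 := (strictMonoOn_phase hN).injOn (h.pos _) (Set.mem_Ioi.2 one_pos)
      (by rw [hph, ← h0, neg_zero, phase_one])
    exact funext fun t => le_antisymm (e0 ▸ h₀ t) (e1 ▸ h₁ t)
  · right
    have huniq (Z Z' : ℝ → ℝ) (hZ : IsOrbit N (phase N (X t₀)) Z Z') :
        (fun t => X (t + t₀)) = Z := by
      refine (h.comp_add t₀).ext hZ.toIsSol ?_ ?_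
      · rw [hZ.zero, phaseInv_phase hN (h.pos _), zero_add]
      · rw [hZ.zero', zero_add, d₀]
    refine ⟨-t₀, _, hρ, h0, ?_, fun Z Z' hZ t => ?_⟩
    · obtain ⟨Z, Z', hZ⟩ := exists_isOrbit hN hρ
      have hZX := huniq Z Z' hZ
      have hZT : Z T = Z 0 := by
        rw [← hZX]
        have := hp t₀
        simpa [add_comm] using this
      obtain ⟨j, hj⟩ := hZ.eq_zero h0 T hZT
      have hP := period_pos hN hρ
      have hj0 : 0 < j := by
        have : 0 < (j : ℝ) * period N (phase N (X t₀)) := hj ▸ hT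
        exact_mod_cast pos_of_mul_pos_left this hP.le
      obtain ⟨n, rfl⟩ := Int.eq_ofNat_of_zero_le hj0.le
      exact ⟨n, by exact_mod_cast hj0, by exact_mod_cast hj⟩
    · rw [← huniq Z Z' hZ]
      simp

theorem IsOrbit.periodic_iff {X X' : ℝ → ℝ} (h : IsOrbit N ρ X X') (hρ : 0 < ρ) (s : ℝ) :
    Function.Periodic X s ↔ ∃ l : ℤ, s = l * period N ρ := by
  constructor
  · intro hs
    refine h.eq_zero hρ s ?_
    simpa using hs 0
  · rintro ⟨l, rfl⟩
    exact h.periodic.int_mul l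

/-- The positive `T`-periodic solutions of `x'' = x - x ^ (N + 1)`, up to translation. -/
theorem exists_periodic_solutions (hN : 1 ≤ N) {k : ℕ} (hk : 1 ≤ k) (hT : 0 < T)
    (hT₁ : 2 * Real.pi * ((k : ℝ) - 1) / √N < T) (hT₂ : T ≤ 2 * Real.pi * (k : ℝ) / √N) :
    ∃ X X' : Fin k → ℝ → ℝ, (X ⟨0, hk⟩ = fun _ => 1) ∧ (∀ i, IsSol N (X i) (X' i)) ∧
      (∀ i, Function.Periodic (X i) T) ∧
      (∀ i j, (∃ c : ℝ, c ≠ 0 ∧ ∃ a, ∀ t, X i t = c * X j (t + a)) → i = j) ∧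
      ∀ Y Y', IsSol N Y Y' → Function.Periodic Y T → ∃ j a, ∀ t, Y t = X j (t + a) := by
  have hN0 : (0 : ℝ) < √N := Real.sqrt_pos.2 (by positivity)
  have key (i : Fin k) : ∃ X X' : ℝ → ℝ, IsSol N X X' ∧ (i.1 = 0 → X = fun _ => 1) ∧
      (i.1 ≠ 0 → ∃ ρ ∈ amplitudes N, 0 < ρ ∧ period N ρ = T / i.1 ∧ IsOrbit N ρ X X') := by
    by_cases hi : i.1 = 0
    · exact ⟨_, _, isSol_one N, fun _ => rfl, fun h => absurd hi h⟩
    · have hi0 : (0 : ℝ) < i.1 := by exact_mod_cast Nat.pos_of_ne_zero hi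
      have hik : (i.1 : ℝ) ≤ k - 1 := by
        have : (i.1 : ℝ) + 1 ≤ k := by exact_mod_cast i.2
        linarith
      -- The lower bound on `T` is used here: `i ≤ k - 1` gives `T/i > 2π/√N`.
      obtain ⟨ρ, hρ, hρ0, hP⟩ := exists_period_eq hN (P := T / i.1) (by
        rw [lt_div_iff₀ hi0]
        refine lt_of_le_of_lt ?_ hT₁
        rw [div_mul_eq_mul_div]
        gcongr)
      obtain ⟨X, X', hX⟩ := exists_isOrbit hN hρ
      exact ⟨X, X', hX.toIsSol, fun h => absurd h hi, fun _ => ⟨ρ, hρ, hρ0, hP, hX⟩⟩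
  choose X X' hsol hzero horb using key
  have hper (i : Fin k) (hi : i.1 ≠ 0) (s : ℝ) :
      Function.Periodic (X i) s ↔ ∃ l : ℤ, s = l * (T / i.1) := by
    obtain ⟨ρ, hρ, hρ0, hP, hX⟩ := horb i hi
    rw [hX.periodic_iff hρ0, hP]
  have hper0 (i : Fin k) (hi : i.1 = 0) (s : ℝ) : Function.Periodic (X i) s := by
    rw [hzero i hi]
    exact fun _ => rfl
  have hcast (i : Fin k) (hi : i.1 ≠ 0) : (0 : ℝ) < i.1 := by
    exact_mod_cast Nat.pos_of_ne_zero hi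
  have haux (i j : Fin k) (hi : i.1 ≠ 0) (hj : j.1 ≠ 0)
      (h : ∀ s, Function.Periodic (X i) s ↔ Function.Periodic (X j) s) : i.1 ∣ j.1 := by
    have hi' := hcast i hi
    have hj' := hcast j hj
    obtain ⟨l, hl⟩ := (hper j hj (T / i.1)).1 ((h _).1 ((hper i hi _).2 ⟨1, by simp⟩))
    have : (j.1 : ℝ) = i.1 * l := by
      field_simp at hl
      exact hl
    exact Int.natCast_dvd_natCast.1 ⟨l, by exact_mod_cast this⟩
  have haux0 (i j : Fin k) (hi : i.1 = 0)
      (h : ∀ s, Function.Periodic (X i) s ↔ Function.Periodic (X j) s) : j.1 = 0 := by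
    by_contra hj
    have hj' := hcast j hj
    obtain ⟨l, hl⟩ := (hper j hj (T / j.1 / 2)).1 ((h _).1 (hper0 i hi _))
    have h1 : (1 : ℝ) = 2 * l := by
      field_simp at hl
      linarith
    have h2 : (1 : ℤ) = 2 * l := by exact_mod_cast h1
    omega
  refine ⟨X, X', hzero _ rfl, hsol, fun i => ?_, ?_, ?_⟩
  · by_cases hi : i.1 = 0
    · exact hper0 i hi T
    · have := hcast i hi
      exact (hper i hi T).2 ⟨i.1, by push_cast; field_simp⟩
  · rintro i j ⟨c, hc, a, h⟩
    -- Scaling and translation preserve the set of periods, which is `ℤ · T/i` for index `i > 0` and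
    -- all of `ℝ` for index `0`, so it determines the index.
    have hiff (s : ℝ) : Function.Periodic (X i) s ↔ Function.Periodic (X j) s := by
      constructor
      · intro hs t
        have := hs (t - a)
        rw [h, h] at this
        have := mul_left_cancel₀ hc this
        rwa [sub_add_cancel, show t - a + s + a = t + s by ring] at this
      · intro hs t
        rw [h, h, show t + s + a = t + a + s by ring, hs]
    apply Fin.ext
    by_cases hi : i.1 = 0
    · rw [hi, haux0 i j hi hiff]
    · by_cases hj : j.1 = 0
      · exact absurd (haux0 j i hj fun s => (hiff s).symm) hi
      · exact Nat.dvd_antisymm (haux i j hi hj hiff) (haux j i hj hi fun s => (hiff s).symm)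
  · intro Y Y' hY hYT
    rcases hY.eq_one_or_orbit hN hT hYT with h | ⟨t₀, ρ, hρ, hρ0, ⟨j, hj, hjT⟩, h⟩
    · exact ⟨⟨0, hk⟩, 0, fun t => by rw [h, hzero _ rfl]⟩
    · have hj' : (0 : ℝ) < j := by exact_mod_cast hj
      -- The upper bound on `T` is used here: every nonconstant orbit has period above `2π/√N`.
      have hjk : j < k := by
        have h1 : (j : ℝ) * (2 * Real.pi / √N) < T := by
          rw [hjT]
          exact mul_lt_mul_of_pos_left (lt_period hN hρ hρ0) hj'
        have h2 := h1.trans_le hT₂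
        rw [← mul_div_assoc, div_lt_div_iff_of_pos_right hN0, mul_comm (j : ℝ)] at h2
        exact_mod_cast lt_of_mul_lt_mul_left h2 Real.two_pi_pos.le
      obtain ⟨ρ', hρ', hρ0', hP, hX⟩ := horb ⟨j, hjk⟩ hj.ne'
      have : ρ = ρ' := by
        refine (strictMonoOn_period hN).injOn hρ hρ' ?_
        rw [hP, hjT]
        field_simp
      subst this
      exact ⟨⟨j, hjk⟩, t₀, h _ _ hX⟩

end PseudoCyl

end

noncomputable section

namespace PseudoCyl

/-! ### Smooth functions on the circle -/

theorem exists_circle_lift {v : ℝ → ℝ} (hv : ContDiff ℝ ∞ v)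
    (hp : Function.Periodic v (2 * Real.pi)) :
    ∃ F : Circle → ℝ, ContMDiff (𝓡 1) 𝓘(ℝ, ℝ) ∞ F ∧ ∀ θ, F (Circle.exp θ) = v θ := by
  have hexp {θ θ' : ℝ} (h : Circle.exp θ = Circle.exp θ') : v θ = v θ' := by
    obtain ⟨n, hn⟩ := Circle.exp_eq_exp.1 h
    rw [hn]
    exact hp.int_mul n θ'
  have hF (θ : ℝ) : v (Complex.arg (Circle.exp θ)) = v θ := hexp (Circle.exp_arg _)
  refine ⟨fun z => v (Complex.arg z), fun z₀ => ?_, hF⟩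
  -- `arg` jumps at `-1`, so near `z₀` it is replaced by the branch of the angle centred at `z₀`;
  -- periodicity of `v` absorbs the difference.
  have heq : (fun z : Circle => v (Complex.arg z)) = fun z : Circle =>
      v (Complex.arg z₀ + (Complex.log ((z : ℂ) * ((z₀⁻¹ : Circle) : ℂ))).im) := by
    funext z
    refine hexp ?_
    rw [Circle.exp_arg, Complex.log_im, ← Circle.coe_mul, Circle.exp_add, Circle.exp_arg,
      Circle.exp_arg]
    simp
  rw [heq]
  have h1 : ContDiffAt ℝ ∞ (fun w : ℂ => v (Complex.arg z₀ +
      (Complex.log (w * ((z₀⁻¹ : Circle) : ℂ))).im)) (z₀ : ℂ) := by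
    have hs : (z₀ : ℂ) * ((z₀⁻¹ : Circle) : ℂ) ∈ Complex.slitPlane := by
      rw [← Circle.coe_mul, mul_inv_cancel, Circle.coe_one]
      exact Complex.one_mem_slitPlane
    have h2 : ContDiffAt ℝ ∞ (fun w : ℂ => Complex.log (w * ((z₀⁻¹ : Circle) : ℂ))) (z₀ : ℂ) :=
      ContDiffAt.comp (z₀ : ℂ) (ContDiffAt.restrict_scalars ℝ (Complex.contDiffAt_log hs))
        (contDiffAt_id.mul contDiffAt_const)
    exact hv.contDiffAt.comp _ (contDiffAt_const.add (Complex.imCLM.contDiff.contDiffAt.comp _ h2))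
  exact ContMDiffAt.comp (I' := 𝓘(ℝ, ℂ)) (f := fun z : Circle => (z : ℂ))
    (g := fun w : ℂ => v (Complex.arg z₀ + (Complex.log (w * ((z₀⁻¹ : Circle) : ℂ))).im)) z₀
    h1.contMDiffAt contMDiff_coe_circle.contMDiffAt

variable {N : ℕ} {T : ℝ}

theorem IsSol.contDiff {X X' : ℝ → ℝ} (h : IsSol N X X') : ContDiff ℝ ∞ X := by
  have hX : _root_.deriv X = X' := funext fun t => (h.deriv t).deriv
  have hX' : _root_.deriv X' = fun t => -force N (X t) := funext fun t => (h.deriv' t).deriv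
  have key (n : ℕ) : ContDiff ℝ n X ∧ ContDiff ℝ n X' := by
    induction n with
    | zero =>
      exact ⟨contDiff_zero.2 h.continuous, contDiff_zero.2
        (continuous_iff_continuousAt.2 fun t => (h.deriv' t).continuousAt)⟩
    | succ n ih =>
      push_cast
      refine ⟨contDiff_succ_iff_deriv.2 ⟨fun t => (h.deriv t).differentiableAt, by simp,
        hX ▸ ih.2⟩, contDiff_succ_iff_deriv.2 ⟨fun t => (h.deriv' t).differentiableAt, by simp, ?_⟩⟩
      rw [hX']
      have := ih.1
      unfold force
      fun_prop
  exact contDiff_infty.2 fun n => (key n).1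

/-! ### The correspondence between metrics and solutions -/

/-- `F (exp θ) = X (T θ / 2π) ^ (-2)`, where `X` is a function on the circle of length `T`. -/
def IsFactor (T : ℝ) (X : ℝ → ℝ) (F : Circle → ℝ) : Prop :=
  ∀ θ, F (Circle.exp θ) = (X (T / (2 * Real.pi) * θ) ^ 2)⁻¹

theorem IsSol.exists_factor {X X' : ℝ → ℝ} (h : IsSol N X X') (hp : Function.Periodic X T) :
    ∃ F : Circle → ℝ, ContMDiff (𝓡 1) 𝓘(ℝ, ℝ) ∞ F ∧ IsFactor T X F := by
  refine exists_circle_lift (v := fun θ => (X (T / (2 * Real.pi) * θ) ^ 2)⁻¹) ?_ fun θ => ?_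
  · have h1 : ContDiff ℝ ∞ fun θ => X (T / (2 * Real.pi) * θ) ^ 2 :=
      (h.contDiff.comp (contDiff_const.mul contDiff_id)).pow 2
    exact h1.inv fun θ => (pow_pos (h.pos _) 2).ne'
  · have : T / (2 * Real.pi) * (θ + 2 * Real.pi) = T / (2 * Real.pi) * θ + T := by
      have := Real.pi_ne_zero
      field_simp
    simp only [this, hp _]

theorem IsFactor.pos {X X' : ℝ → ℝ} {F : Circle → ℝ} (hF : IsFactor T X F) (h : IsSol N X X')
    (z : Circle) : 0 < F z := by
  rw [← Circle.exp_arg z, hF]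
  exact inv_pos.2 (pow_pos (h.pos _) 2)

theorem IsSol.isPseudoCylindric (hN : 1 ≤ N) (hT : 0 < T) {X X' : ℝ → ℝ} (h : IsSol N X X')
    (hp : Function.Periodic X T) {F : Circle → ℝ} (hFs : ContMDiff (𝓡 1) 𝓘(ℝ, ℝ) ∞ F)
    (hF : IsFactor T X F) :
    IsPseudoCylindric T (N + 1) (fun q => F q.1 • productMetric T (N + 1) q) := by
  refine ⟨⟨fun q => F q.1, hFs.comp contMDiff_fst, fun q => hF.pos h q.1, fun _ => rfl⟩,
    (rotationallyInvariant_smul_iff T N.succ_pos fun q => F q.1).2 fun _ _ _ => rfl, ?_⟩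
  obtain ⟨t₀, t₁, d₀, d₁, h₀, h₁, hph⟩ := h.exists_max_min hN hT hp
  have hle : phase N (X t₁) ≤ phase N (X t₀) :=
    (strictMonoOn_phase hN).monotoneOn (h.pos _) (h.pos _) (h₁ t₀)
  have hX1 : X t₁ ≤ 1 := (phase_nonpos_iff hN (h.pos _)).1 (by linarith)
  -- The scalar curvature is `2(N+1)(N+2)` times the gap between the potential at `0` and the
  -- energy, the latter read off at the minimum. The gap is positive because the minimum is at most
  -- `1`.
  refine ⟨(N + 1) * (N + 2) * 2 * (N / (2 * (N + 2)) - potential N (X t₁)), ?_, ?_⟩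
  · have := sub_pos.2 (potential_lt_zero hN (h.pos t₁) hX1)
    positivity
  · rintro ⟨z, ξ⟩
    obtain ⟨θ, rfl⟩ : ∃ θ, Circle.exp θ = z := ⟨_, Circle.exp_arg z⟩
    rw [scalarCurvature_conformal hT N.succ_pos h.pos h.deriv h.deriv' hF]
    have hE := h.energy (T / (2 * Real.pi) * θ) t₁
    rw [d₁] at hE
    generalize T / (2 * Real.pi) * θ = t at *
    have hE' : potential N (X t₁) = X' t ^ 2 / 2 + potential N (X t) := by linarith
    have : (N : ℝ) + 2 ≠ 0 := by positivity
    dsimp only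
    rw [hE', potential, force]
    push_cast
    field_simp
    ring

theorem equivalent_iff (hT : 0 < T) {X Y : ℝ → ℝ} (hX0 : ∀ t, 0 < X t) (hY0 : ∀ t, 0 < Y t)
    {F G : Circle → ℝ} {b : ℝ} (hb : 0 < b)
    (hF : ∀ θ, F (Circle.exp θ) = b * (X (T / (2 * Real.pi) * θ) ^ 2)⁻¹)
    (hG : IsFactor T Y G) {m : ℕ} (hm : 0 < m) :
    Equivalent m (fun q => F q.1 • productMetric T m q) (fun q => G q.1 • productMetric T m q) ↔
      ∃ c : ℝ, 0 < c ∧ ∃ a, ∀ t, X t = c * Y (t + a) := by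
  have hL : T / (2 * Real.pi) ≠ 0 := by positivity
  rw [equivalent_smul_iff T hm (fun q => F q.1) (fun q => G q.1)]
  constructor
  · rintro ⟨c, hc, z, h⟩
    obtain ⟨α, rfl⟩ : ∃ α, Circle.exp α = z := ⟨_, Circle.exp_arg z⟩
    -- Solves `b X⁻² = c Y⁻²` for `X`; a rotation by the angle `α` is a translation of arc length by
    -- `Tα/2π`.
    refine ⟨√(b / c), by positivity, T / (2 * Real.pi) * α, fun t => ?_⟩
    have h1 := h (Circle.exp (t / (T / (2 * Real.pi))), ⟨EuclideanSpace.single 0 1, by simp⟩)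
    simp only [← Circle.exp_add, hF, hG _] at h1
    rw [mul_add, mul_div_cancel₀ _ hL, add_comm _ t] at h1
    have hx := hX0 t
    have hy := hY0 (t + T / (2 * Real.pi) * α)
    rw [← Real.sqrt_sq hx.le, ← Real.sqrt_sq hy.le, ← Real.sqrt_mul (by positivity)]
    congr 1
    generalize Y (t + T / (2 * Real.pi) * α) = y at h1 hy ⊢
    field_simp at h1 ⊢
    linarith
  · rintro ⟨c, hc, a, h⟩
    refine ⟨b / c ^ 2, by positivity, Circle.exp (a / (T / (2 * Real.pi))), ?_⟩
    rintro ⟨z, ξ⟩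
    obtain ⟨θ, rfl⟩ : ∃ θ, Circle.exp θ = z := ⟨_, Circle.exp_arg z⟩
    simp only [← Circle.exp_add, hF, hG _]
    rw [mul_add, mul_div_cancel₀ _ hL, h, add_comm _ a]
    have hy := hY0 (a + T / (2 * Real.pi) * θ)
    field_simp

/-- The equation of constant scalar curvature, in normalized form. -/
theorem exists_isSol_of_scalar_const {X X' X'' : ℝ → ℝ} (hN : 1 ≤ N) (hT : 0 < T)
    (hX0 : ∀ t, 0 < X t) (hX : ∀ t, HasDerivAt X (X' t) t) (hX' : ∀ t, HasDerivAt X' (X'' t) t)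
    (hp : Function.Periodic X T) {R : ℝ}
    (hR : ∀ t, N * X t ^ 2 + 2 * X t * X'' t - (N + 2) * X' t ^ 2 = (N + 2) * R) :
    ∃ b : ℝ, 0 < b ∧ IsSol N (fun t => b * X t) (fun t => b * X' t) := by
  have hX0' (t : ℝ) : X t ≠ 0 := (hX0 t).ne'
  -- This first integral eliminates `X'²` from the curvature equation and leaves `X'' = X -
  -- κX^(N+1)`.
  have hK (t : ℝ) : HasDerivAt (fun t => (X t ^ 2 - X' t ^ 2 - R) / X t ^ (N + 2)) 0 t := by
    refine (((((hX t).fun_pow 2).fun_sub ((hX' t).fun_pow 2)).sub_const R).fun_div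
      ((hX t).fun_pow (N + 2)) (pow_ne_zero _ (hX0' t))).congr_deriv ?_
    rw [div_eq_zero_iff]
    left
    have := hR t
    simp only [pow_succ, pow_zero, show N + 2 - 1 = N + 1 by omega]
    push_cast
    linear_combination (-X' t * X t ^ N * X t) * this
  obtain ⟨K, hKt⟩ : ∃ K, ∀ t, X t ^ 2 - X' t ^ 2 - R = K * X t ^ (N + 2) :=
    ⟨_, fun t => by
      have := is_const_of_deriv_eq_zero (fun r => (hK r).differentiableAt)
        (fun r => (hK r).deriv) t 0
      exact (div_eq_iff (pow_ne_zero _ (hX0' t))).1 this⟩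
  set κ := (N + 2) * K / 2 with hκ
  have hX2 (t : ℝ) : X'' t = X t - κ * X t ^ (N + 1) := by
    have h1 := hR t
    have h2 := hKt t
    have h3 : 2 * X t * X'' t = 2 * X t * (X t - κ * X t ^ (N + 1)) := by
      rw [hκ]
      rw [pow_succ (X t) (N + 1)] at h2
      linear_combination h1 - (N + 2) * h2
    exact mul_left_cancel₀ (mul_ne_zero two_ne_zero (hX0' t)) h3
  -- Otherwise `X'' > 0` everywhere, and a strictly increasing `X'` cannot be periodic.
  have hκ0 : 0 < κ := by
    by_contra hneg
    have hpos (t : ℝ) : 0 < X'' t := by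
      rw [hX2]
      have := mul_nonneg (neg_nonneg.2 (not_lt.1 hneg)) (pow_pos (hX0 t) (N + 1)).le
      linarith [hX0 t]
    have hmono : StrictMono X' := strictMono_of_deriv_pos fun t => by
      rw [(hX' t).deriv]
      exact hpos t
    have h1 : HasDerivAt X (X' (0 + T)) 0 := by
      have := (hX (0 + T)).comp_add_const 0 T
      rwa [show (fun t => X (t + T)) = X from funext hp] at this
    have h2 := hmono hT
    rw [zero_add] at h1
    exact h2.ne ((hX 0).unique h1)
  have hNne : N ≠ 0 := by omega
  have hb : (κ ^ (1 / N : ℝ)) ^ N = κ := by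
    rw [one_div]
    exact Real.rpow_inv_natCast_pow hκ0.le hNne
  have hb0 : 0 < κ ^ (1 / N : ℝ) := Real.rpow_pos_of_pos hκ0 _
  generalize κ ^ (1 / N : ℝ) = b at hb hb0
  refine ⟨b, hb0, fun t => mul_pos hb0 (hX0 t), fun t => (hX t).const_mul b, fun t => ?_⟩
  refine ((hX' t).const_mul b).congr_deriv ?_
  rw [hX2, force, mul_pow, pow_succ b, hb]
  ring

theorem IsPseudoCylindric.exists_isSol (hN : 1 ≤ N) (hT : 0 < T)
    {h : TwoTensor (cylModel (N + 1)) (Cyl (N + 1))} (hh : IsPseudoCylindric T (N + 1) h) :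
    ∃ X X', IsSol N X X' ∧ Function.Periodic X T ∧ ∃ b : ℝ, 0 < b ∧ ∃ F : Circle → ℝ,
      (∀ θ, F (Circle.exp θ) = b * (X (T / (2 * Real.pi) * θ) ^ 2)⁻¹) ∧
      h = fun q => F q.1 • productMetric T (N + 1) q := by
  obtain ⟨⟨f, hf, hf0, hfh⟩, hrot, R, -, hR⟩ := hh
  obtain rfl : h = fun q => f q • productMetric T (N + 1) q := funext hfh
  have hrot := (rotationallyInvariant_smul_iff T N.succ_pos f).1 hrot
  let ξ₀ : Sph (N + 1) := ⟨EuclideanSpace.single 0 1, by simp⟩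
  let F : Circle → ℝ := fun z => f (z, ξ₀)
  have hfF : f = fun q => F q.1 := funext fun q => hrot q.1 q.2 ξ₀
  have hF0 (z : Circle) : 0 < F z := hf0 _
  have hL : 0 < T / (2 * Real.pi) := by positivity
  set L := T / (2 * Real.pi) with hLdef
  have hv : ContDiff ℝ ∞ fun t : ℝ => F (Circle.exp (t / L)) := by
    rw [← contMDiff_iff_contDiff]
    have h1 : ContMDiff 𝓘(ℝ, ℝ) (cylModel (N + 1)) ∞
        (fun t : ℝ => ((Circle.exp (t / L), ξ₀) : Cyl (N + 1))) := by
      refine ContMDiff.prodMk ?_ contMDiff_const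
      exact contMDiff_circleExp.comp (contDiff_id.div_const L).contMDiff
    exact hf.comp h1
  let X : ℝ → ℝ := fun t => (√(F (Circle.exp (t / L))))⁻¹
  have hX0 (t : ℝ) : 0 < X t := inv_pos.2 (Real.sqrt_pos.2 (hF0 _))
  have hXs : ContDiff ℝ ∞ X :=
    (hv.sqrt fun t => (hF0 _).ne').inv fun t => (Real.sqrt_pos.2 (hF0 _)).ne'
  have hX's : ContDiff ℝ ∞ (deriv X) := (contDiff_infty_iff_deriv.1 hXs).2
  have hX (t : ℝ) : HasDerivAt X (deriv X t) t :=
    (hXs.differentiable (by simp) t).hasDerivAt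
  have hX' (t : ℝ) : HasDerivAt (deriv X) (deriv (deriv X) t) t :=
    (hX's.differentiable (by simp) t).hasDerivAt
  have hXF : IsFactor T X F := fun θ => by
    simp only [X]
    rw [inv_pow, inv_inv, Real.sq_sqrt (hF0 _).le, ← hLdef, mul_div_cancel_left₀ _ hL.ne']
  have hp : Function.Periodic X T := fun t => by
    have : (t + T) / L = t / L + 2 * Real.pi := by
      rw [hLdef]
      field_simp
    simp only [X, this, Circle.exp_add, Circle.exp_two_pi, mul_one]
  have hscal (t : ℝ) : N * X t ^ 2 + 2 * X t * deriv (deriv X) t - (N + 2) * deriv X t ^ 2 =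
      (N + 2) * (R / ((N + 1) * (N + 2))) := by
    have h1 := hR (Circle.exp (t / L), ξ₀)
    rw [hfF, scalarCurvature_conformal hT N.succ_pos hX0 hX hX' hXF] at h1
    rw [← hLdef, mul_div_cancel₀ _ hL.ne'] at h1
    have : (N : ℝ) + 1 ≠ 0 := by positivity
    have : (N : ℝ) + 2 ≠ 0 := by positivity
    field_simp
    rw [← h1]
    push_cast
    ring
  obtain ⟨b, hb, hsol⟩ := exists_isSol_of_scalar_const hN hT hX0 hX hX' hp hscal
  refine ⟨_, _, hsol, fun t => by simp only [hp t], b ^ 2, by positivity, F, fun θ => ?_, ?_⟩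
  · rw [hXF θ, mul_pow, mul_inv, mul_inv_cancel_left₀ (by positivity)]
  · rw [hfF]

theorem exists_pseudoCylindric (hN : 1 ≤ N) {k : ℕ} (hk : 1 ≤ k)
    (hT₁ : 2 * Real.pi * ((k : ℝ) - 1) / √N < T) (hT₂ : T ≤ 2 * Real.pi * (k : ℝ) / √N) :
    ∃ g : Fin k → TwoTensor (cylModel (N + 1)) (Cyl (N + 1)),
      g ⟨0, hk⟩ = productMetric T (N + 1) ∧
      (∀ j, IsPseudoCylindric T (N + 1) (g j)) ∧
      (∀ i j, Equivalent (N + 1) (g i) (g j) → i = j) ∧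
      (∀ h, IsPseudoCylindric T (N + 1) h → ∃ j, Equivalent (N + 1) h (g j)) := by
  -- Positivity of the length follows from the strict lower bound, since `k ≥ 1`.
  have hT : 0 < T := by
    refine lt_of_le_of_lt ?_ hT₁
    have : (1 : ℝ) ≤ k := by exact_mod_cast hk
    have := sub_nonneg.2 this
    positivity
  obtain ⟨X, X', hX0, hsol, hper, hinj, hsurj⟩ := exists_periodic_solutions hN hk hT hT₁ hT₂
  choose F hFs hF using fun i => (hsol i).exists_factor (hper i)
  refine ⟨fun i q => F i q.1 • productMetric T (N + 1) q, ?_, fun i =>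
    (hsol i).isPseudoCylindric hN hT (hper i) (hFs i) (hF i), fun i j h => ?_, fun h hh => ?_⟩
  · funext q
    have : F ⟨0, hk⟩ q.1 = 1 := by
      rw [← Circle.exp_arg q.1, hF, hX0]
      simp
    simp only [this, one_smul]
  · obtain ⟨c, hc, h⟩ := (equivalent_iff hT (hsol i).pos (hsol j).pos one_pos
      (fun θ => by rw [hF i θ, one_mul]) (hF j) N.succ_pos).1 h
    exact hinj i j ⟨c, hc.ne', h⟩
  · obtain ⟨Y, Y', hY, hYT, b, hb, G, hG, rfl⟩ := hh.exists_isSol hN hT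
    obtain ⟨j, a, hj⟩ := hsurj Y Y' hY hYT
    exact ⟨j, (equivalent_iff hT hY.pos (hsol j).pos hb hG (hF j) N.succ_pos).2
      ⟨1, one_pos, a, fun t => by rw [hj, one_mul]⟩⟩

end PseudoCyl

end

theorem mainTheorem1 (n k : ℕ) (hn : 3 ≤ n) (hk : 1 ≤ k) (T : ℝ)
    (hT₁ : 2 * Real.pi * ((k : ℝ) - 1) / Real.sqrt ((n : ℝ) - 2) < T)
    (hT₂ : T ≤ 2 * Real.pi * (k : ℝ) / Real.sqrt ((n : ℝ) - 2)) :
    (∃ g : Fin k → PseudoCyl.TwoTensor (PseudoCyl.cylModel (n - 1)) (PseudoCyl.Cyl (n - 1)),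
      g ⟨0, hk⟩ = PseudoCyl.productMetric T (n - 1) ∧
      (∀ j, PseudoCyl.IsPseudoCylindric T (n - 1) (g j)) ∧
      (∀ i j, PseudoCyl.Equivalent (n - 1) (g i) (g j) → i = j) ∧
      (∀ h, PseudoCyl.IsPseudoCylindric T (n - 1) h →
        ∃ j, PseudoCyl.Equivalent (n - 1) h (g j))) ∧
    (k = 1 → ∀ h, PseudoCyl.IsPseudoCylindric T (n - 1) h →
      ∃ c : ℝ, 0 < c ∧ ∀ p, h p = c • PseudoCyl.productMetric T (n - 1) p) := by
  obtain ⟨N, rfl⟩ : ∃ N, n = N + 2 := ⟨n - 2, by omega⟩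
  have hN : 1 ≤ N := by omega
  rw [show ((N + 2 : ℕ) : ℝ) - 2 = N by push_cast; ring] at hT₁ hT₂
  have hex := PseudoCyl.exists_pseudoCylindric hN hk hT₁ hT₂
  refine ⟨hex, ?_⟩
  rintro rfl h hh
  obtain ⟨g, hg0, -, -, hg⟩ := hex
  obtain ⟨j, c, hc, a, hj⟩ := hg h hh
  obtain rfl : j = ⟨0, hk⟩ := Subsingleton.elim _ _
  refine ⟨c, hc, fun p => ?_⟩
  have h1 := hj p
  rw [hg0, PseudoCyl.pullback_rotateCircle_productMetric] at h1
  exact h1
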